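/- Let $(M,\Pi)$ be a smooth Poisson manifold of dimension $n$, with Poisson bracket $\{f,g\}=\Pi(df,dg)$ and with $\Pi^\sharp:T^*M\to TM$ given by $\beta(\Pi^\sharp(\alpha))=\Pi(\alpha,\beta)$; the Hamiltonian vector field $X_f$ of a (local) smooth function $f$ is given by $X_f(h)=\{h,f\}$. Let $\mathfrak F$ be a smooth $r$-dimensional foliation of $M$, with tangent bundle $T\mathfrak F$ and annihilator $(T\mathfrak F)^\circ\subset T^*M$. A (local) first integral of $\mathfrak F$ is a smooth function on an open subset $U\subset M$ which is constant on the leaves of $\mathfrak F|_U$. We say that $(M,\Pi,\mathfrak F)$ is an abstract non-commutative integrable (NCI) system of rank $r$ if $T\mathfrak F$ is spanned by Hamiltonian vector fields of local first integrals of $\mathfrak F$, i.e., if every $m\in M$ has an open neighborhood $U$ with first integrals $f_1,\dots,f_r$ of $\mathfrak F$ on $U$ such that $X_{f_1}|_{m'},\dots,X_{f_r}|_{m'}$ span $T_{m'}\mathfrak F$ for all $m'\in U$. We say that $\mathfrak F$ is Poisson complete if for every open $U\subset M$ the Poisson bracket of any two first integrals of $\mathfrak F$ on $U$ is a first integral of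 $\mathfrak F$ on $U$, and that $\mathfrak F$ is isotropic if $T\mathfrak F\subset\Pi^\sharp((T\mathfrak F)^\circ)$. The Poisson structure $\Pi$ is regular if the rank of $\Pi^\sharp_m$ does not depend on $m\in M$. (1) If $(M,\Pi,\mathfrak F)$ is an abstract NCI system, then $\mathfrak F$ is both Poisson complete and isotropic. (2) If $\Pi$ is regular and $\mathfrak F$ is both Poisson complete and isotropic, then $(M,\Pi,\mathfrak F)$ is an abstract NCI system. -/

import Mathlib

open scoped Manifold ContDiff Topology

noncomputable section

namespace NCI

/-- The coordinates of `ℝⁿ` with index `≥ r`: the projection `ℝⁿ = ℝʳ × ℝⁿ⁻ʳ → ℝⁿ⁻ʳ`. -/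
def transverse (n r : ℕ) :
    EuclideanSpace ℝ (Fin n) →ₗ[ℝ] ({i : Fin n // r ≤ (i : ℕ)} → ℝ) where
  toFun v i := v i.1
  map_add' _ _ := rfl
  map_smul' _ _ := rfl

section

variable {n : ℕ} {M : Type*} [TopologicalSpace M] [ChartedSpace (EuclideanSpace ℝ (Fin n)) M]

/-- The tangent space `T_x M` of an `n`-dimensional manifold. -/
abbrev Tan (n : ℕ) {M : Type*} [TopologicalSpace M]
    [ChartedSpace (EuclideanSpace ℝ (Fin n)) M] (x : M) : Type :=
  TangentSpace (𝓡 n) x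

instance (x : M) : FiniteDimensional ℝ (Tan n x) :=
  inferInstanceAs (FiniteDimensional ℝ (EuclideanSpace ℝ (Fin n)))

/-- `f` is (defined and) smooth on `U`; for a function on an open set `U`, the values of
`f : M → ℝ` off `U` are irrelevant. -/
abbrev SmoothOn (n : ℕ) {M : Type*} [TopologicalSpace M]
    [ChartedSpace (EuclideanSpace ℝ (Fin n)) M] (f : M → ℝ) (U : Set M) : Prop :=
  ContMDiffOn (𝓡 n) 𝓘(ℝ, ℝ) ∞ f U

/-- The differential `d_x f`, as a covector at `x`. -/
def diff (n : ℕ) {M : Type*} [TopologicalSpace M]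
    [ChartedSpace (EuclideanSpace ℝ (Fin n)) M] (f : M → ℝ) (x : M) :
    Module.Dual ℝ (Tan n x) :=
  (mfderiv (𝓡 n) 𝓘(ℝ, ℝ) f x).toLinearMap

/-- The differential of (a chart) `e : M → ℝⁿ` at `x`, as a linear map `T_x M → ℝⁿ`. -/
def vecDiff (n : ℕ) {M : Type*} [TopologicalSpace M]
    [ChartedSpace (EuclideanSpace ℝ (Fin n)) M] (e : M → EuclideanSpace ℝ (Fin n)) (x : M) :
    Tan n x →ₗ[ℝ] EuclideanSpace ℝ (Fin n) :=
  (mfderiv (𝓡 n) (𝓡 n) e x).toLinearMap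

/-- A field of bilinear forms on the cotangent spaces evaluated on two differentials:
`x ↦ Π_x (d_x f, d_x g)`. -/
def bracketOf (biv : ∀ x : M, Module.Dual ℝ (Tan n x) →ₗ[ℝ] Module.Dual ℝ (Tan n x) →ₗ[ℝ] ℝ)
    (f g : M → ℝ) (x : M) : ℝ :=
  biv x (diff n f x) (diff n g x)

end

/-- A Poisson structure on a smooth `n`-manifold `M`: a smooth bivector field `Π`, regarded as a
field of alternating bilinear forms on the cotangent spaces, whose bracket
`{f, g} = Π (df, dg)` on (local) smooth functions satisfies the Jacobi identity. Smoothness of `Π`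
means that `{f, g}` is smooth for all (local) smooth functions `f`, `g`, for instance for
local coordinates, where one obtains the components of `Π`. -/
structure PoissonStructure (n : ℕ) (M : Type*) [TopologicalSpace M]
    [ChartedSpace (EuclideanSpace ℝ (Fin n)) M] where
  /-- the bivector `Π_x` -/
  biv : ∀ x : M, Module.Dual ℝ (Tan n x) →ₗ[ℝ] Module.Dual ℝ (Tan n x) →ₗ[ℝ] ℝ
  alt : ∀ (x : M) (α : Module.Dual ℝ (Tan n x)), biv x α α = 0
  smooth : ∀ (U : Set M), IsOpen U → ∀ f g : M → ℝ, SmoothOn n f U → SmoothOn n g U →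
    SmoothOn n (bracketOf biv f g) U
  jacobi : ∀ (U : Set M), IsOpen U → ∀ f g h : M → ℝ,
    SmoothOn n f U → SmoothOn n g U → SmoothOn n h U → ∀ x ∈ U,
      bracketOf biv f (bracketOf biv g h) x + bracketOf biv g (bracketOf biv h f) x +
        bracketOf biv h (bracketOf biv f g) x = 0

namespace PoissonStructure

variable {n : ℕ} {M : Type*} [TopologicalSpace M] [ChartedSpace (EuclideanSpace ℝ (Fin n)) M]

/-- The Poisson bracket `{f, g} = Π (df, dg)`. -/
def bracket (P : PoissonStructure n M) (f g : M → ℝ) : M → ℝ :=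
  bracketOf P.biv f g

/-- The map `Π^♯ : T*_x M → T_x M`, determined by `β (Π^♯ α) = Π (α, β)`. -/
def sharp (P : PoissonStructure n M) (x : M) : Module.Dual ℝ (Tan n x) →ₗ[ℝ] Tan n x :=
  (Module.evalEquiv ℝ (Tan n x)).symm.toLinearMap ∘ₗ P.biv x

theorem apply_sharp (P : PoissonStructure n M) (x : M) (α β : Module.Dual ℝ (Tan n x)) :
    β (P.sharp x α) = P.biv x α β :=
  Module.apply_evalEquiv_symm_apply (R := ℝ) (M := Tan n x) β (P.biv x α)

/-- The Hamiltonian vector field `X_f`, with the sign convention `X_f (h) = {h, f}`. -/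
def ham (P : PoissonStructure n M) (f : M → ℝ) (x : M) : Tan n x :=
  - P.sharp x (diff n f x)

theorem apply_ham (P : PoissonStructure n M) (f h : M → ℝ) (x : M) :
    diff n h x (P.ham f x) = P.bracket h f x := by
  have h1 := P.alt x (diff n f x + diff n h x)
  simp only [map_add, LinearMap.add_apply, P.alt] at h1
  rw [ham, map_neg, apply_sharp, bracket, bracketOf]
  linarith

/-- The rank of `Π` at `x`. -/
def rank (P : PoissonStructure n M) (x : M) : ℕ :=
  Module.finrank ℝ (LinearMap.range (P.sharp x))

/-- `Π` is regular if its rank is constant. -/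
def IsRegular (P : PoissonStructure n M) : Prop :=
  ∃ k : ℕ, ∀ x : M, P.rank x = k

end PoissonStructure

/-- A smooth `r`-dimensional foliation of an `n`-manifold `M`, given by a foliated atlas: smooth
charts of `M` that cover `M`, such that each transition map between them has locally the form
`(x, y) ↦ (g (x, y), h y)` on `ℝʳ × ℝⁿ⁻ʳ`, that is, locally the transverse coordinates of a point
in one chart determine those in the other one. -/
structure Foliation (n r : ℕ) (M : Type*) [TopologicalSpace M]
    [ChartedSpace (EuclideanSpace ℝ (Fin n)) M] where
  dim_le : r ≤ n
  /-- the foliated charts -/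
  charts : Set (OpenPartialHomeomorph M (EuclideanSpace ℝ (Fin n)))
  smooth : charts ⊆ IsManifold.maximalAtlas (𝓡 n) ∞ M
  cover : ∀ x : M, ∃ e ∈ charts, x ∈ e.source
  compat : ∀ e ∈ charts, ∀ e' ∈ charts, ∀ x ∈ e.source ∩ e'.source,
    ∃ V ∈ 𝓝 x, ∀ p ∈ V, ∀ q ∈ V,
      transverse n r (e p) = transverse n r (e q) →
        transverse n r (e' p) = transverse n r (e' q)

namespace Foliation

variable {n r : ℕ} {M : Type*} [TopologicalSpace M] [ChartedSpace (EuclideanSpace ℝ (Fin n)) M]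

/-- The tangent space `T_x 𝓕` of the foliation at `x`: the vectors that are killed by the
differentials of the transverse coordinates in the foliated charts around `x` (by
compatibility, all these charts give the same subspace). -/
def tangent (F : Foliation n r M) (x : M) : Submodule ℝ (Tan n x) :=
  ⨅ e ∈ F.charts, ⨅ _ : x ∈ e.source,
    LinearMap.ker (transverse n r ∘ₗ vecDiff n e x)

/-- The leaf through `x` of the restriction of the foliation to the open set `U`: the points
that can be joined to `x` by a path in `U` along which, in each foliated chart, the transverse
coordinates are locally constant (a path that is continuous for the leaf topology). For
`U = Set.univ` this is the leaf of the foliation through `x`. -/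
def leaf (F : Foliation n r M) (U : Set M) (x : M) : Set M :=
  {y | ∃ γ : Path x y, (∀ t, γ t ∈ U) ∧
    ∀ t, ∀ e ∈ F.charts, γ t ∈ e.source →
      ∀ᶠ s in 𝓝 t, transverse n r (e (γ s)) = transverse n r (e (γ t))}

/-- `f` is a first integral, defined on the open set `U`, of the foliation: a smooth function on
`U` that is constant on the leaves (of the restriction to `U`) of the foliation. -/
def IsFirstIntegralOn (F : Foliation n r M) (f : M → ℝ) (U : Set M) : Prop :=
  SmoothOn n f U ∧ ∀ x ∈ U, ∀ y ∈ F.leaf U x, f y = f x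

/-- The Poisson bracket of two local first integrals is a local first integral. -/
def IsPoissonComplete (F : Foliation n r M) (P : PoissonStructure n M) : Prop :=
  ∀ U : Set M, IsOpen U → ∀ g h : M → ℝ,
    F.IsFirstIntegralOn g U → F.IsFirstIntegralOn h U →
      F.IsFirstIntegralOn (P.bracket g h) U

/-- `T𝓕 ⊆ Π^♯ (T𝓕)°`, where `(T𝓕)°` is the annihilator of `T𝓕` in the cotangent bundle. -/
def IsIsotropic (F : Foliation n r M) (P : PoissonStructure n M) : Prop :=
  ∀ x : M, F.tangent x ≤ (F.tangent x).dualAnnihilator.map (P.sharp x)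

/-- The `r`-dimensional foliation `𝓕` is an abstract NCI system (of rank `r`) on `(M, Π)`: `T𝓕`
is spanned, in a neighborhood of each point, by the Hamiltonian vector fields of `r` local first
integrals of `𝓕`. -/
def IsAbstractNCI (F : Foliation n r M) (P : PoissonStructure n M) : Prop :=
  ∀ m : M, ∃ U : Set M, IsOpen U ∧ m ∈ U ∧ ∃ f : Fin r → M → ℝ,
    (∀ i, F.IsFirstIntegralOn (f i) U) ∧
      ∀ m' ∈ U, Submodule.span ℝ (Set.range fun i => P.ham (f i) m') = F.tangent m'

end Foliation

end NCI

end

/-! A function on an open set is a first integral exactly when its differential annihilates T𝓕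
(`isFirstIntegralOn_iff`); this turns everything into linear algebra and differential equations.

(1) If T𝓕 is spanned by the fields X_{f_i} of first integrals f_i, it is isotropic because X_{f_i} =
-Π^♯(df_i). Moreover {k, f_i} = dk(X_{f_i}) = 0 for each first integral k, so the Jacobi identity
gives {{g, k}, f_i} = 0, and {g, k} is a first integral.

(2) Put G = Π^♯(T𝓕)°. By isotropy T𝓕 ⊆ G and ker Π^♯ ⊆ (T𝓕)°, so dim G = rank Π - r, which is
constant when Π is regular (`finrank_map_sharp`). Locally G is spanned by the Hamiltonian fields of
the transverse coordinates, and Poisson completeness makes it involutive, since [X_f, X_g] =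
-X_{{f,g}}. By antisymmetry and isotropy Π^♯(G°) = T𝓕, so a basis of T_m𝓕 has the form Π^♯α_i with
α_i ∈ G°. Frobenius' theorem extends each α_i to an exact df_i that annihilates G near m
(`exists_function`). The f_i are first integrals because T𝓕 ⊆ G, and X_{f_i} is tangent to 𝓕 because
df_i ∈ G°. Independence persists near m, so the r fields span T𝓕.

Frobenius' theorem is derived from smooth dependence of an ODE on parameters, which in turn comes
from the implicit function theorem in the Banach space C([0,1], E). -/

noncomputable section

/-! ### Smoothness of composition operators on spaces of continuous curves -/

section CompositionOperator

variable {K : Type} [TopologicalSpace K] [CompactSpace K]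
  {E : Type} [NormedAddCommGroup E] [NormedSpace ℝ E]
  {F : Type} [NormedAddCommGroup F] [NormedSpace ℝ F]

/-- The pointwise evaluation `(L, γ) ↦ (t ↦ L t (γ t))` of a continuous family of operators. -/
def pointwiseApply (K : Type) [TopologicalSpace K] [CompactSpace K]
    (E : Type) [NormedAddCommGroup E] [NormedSpace ℝ E]
    (F : Type) [NormedAddCommGroup F] [NormedSpace ℝ F] :
    C(K, E →L[ℝ] F) →L[ℝ] C(K, E) →L[ℝ] C(K, F) :=
  LinearMap.mkContinuous₂
    (LinearMap.mk₂ ℝ (fun (L : C(K, E →L[ℝ] F)) (γ : C(K, E)) =>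
        (⟨fun t => L t (γ t), L.continuous.clm_apply γ.continuous⟩ : C(K, F)))
      (fun _ _ _ => by ext; simp) (fun _ _ _ => by ext; simp)
      (fun _ _ _ => by ext; simp) (fun _ _ _ => by ext; simp)) 1
    (fun L γ => by
      rw [one_mul, ContinuousMap.norm_le _ (by positivity)]
      intro t
      simp only [LinearMap.mk₂_apply, ContinuousMap.coe_mk]
      exact (L t).le_of_opNorm_le_of_le (L.norm_coe_le_norm t) (γ.norm_coe_le_norm t))

@[simp]
theorem pointwiseApply_apply (L : C(K, E →L[ℝ] F)) (γ : C(K, E)) (t : K) :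
    pointwiseApply K E F L γ t = L t (γ t) := rfl

theorem hasFDerivAt_postcomp (A : C(E, F)) (A' : C(E, E →L[ℝ] F))
    (h : ∀ x, HasFDerivAt A (A' x) x) (γ : C(K, E)) :
    HasFDerivAt (fun γ : C(K, E) => A.comp γ) (pointwiseApply K E F (A'.comp γ)) γ := by
  rw [hasFDerivAt_iff_isLittleO_nhds_zero, Asymptotics.isLittleO_iff]
  intro ε hε
  have hc : Continuous fun γ : C(K, E) => A'.comp γ := ContinuousMap.continuous_postcomp A'
  obtain ⟨δ, hδ, H⟩ := (Metric.continuous_iff (α := C(K, E)) (β := C(K, E →L[ℝ] F))).1 hc γ ε hε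
  filter_upwards [Metric.ball_mem_nhds (0 : C(K, E)) hδ] with η hη
  rw [ContinuousMap.norm_le _ (by positivity)]
  intro t
  have hη' : ‖η‖ < δ := by simpa using hη
  -- Translating the whole curve by the constant z - γ t gives a curve within δ of γ that passes
  -- through z at t; hence δ is uniform in t.
  have hb : ∀ z ∈ Metric.ball (γ t) δ, ‖A' z - A' (γ t)‖ ≤ ε := by
    intro z hz
    have h1 := H (γ + ContinuousMap.const K (z - γ t)) (by
      rw [dist_eq_norm, add_sub_cancel_left]
      refine lt_of_le_of_lt ?_ (mem_ball_iff_norm.1 hz)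
      rw [ContinuousMap.norm_le _ (norm_nonneg _)]
      intro s; simp)
    have h2 := (ContinuousMap.dist_apply_le_dist (f := A'.comp (γ + ContinuousMap.const K (z - γ t)))
      (g := A'.comp γ) t).trans h1.le
    simpa [dist_eq_norm] using h2
  have h3 := (convex_ball (γ t) δ).norm_image_sub_le_of_norm_hasFDerivWithin_le'
    (f := A) (f' := A') (φ := A' (γ t)) (x := γ t) (y := γ t + η t)
    (fun z _ => (h z).hasFDerivWithinAt) hb (Metric.mem_ball_self hδ)
    (by rw [mem_ball_iff_norm, add_sub_cancel_left]
        exact (η.norm_coe_le_norm t).trans_lt hη')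
  rw [add_sub_cancel_left] at h3
  exact h3.trans (mul_le_mul_of_nonneg_left (η.norm_coe_le_norm t) hε.le)

/-- The derivative is a bounded linear map applied to the composition operator of `fderiv ℝ A`, so
induction on n applies once the target space is allowed to vary. -/
theorem contDiff_postcomp_nat (n : ℕ) :
    ∀ {F : Type} [NormedAddCommGroup F] [NormedSpace ℝ F] (A : C(E, F)), ContDiff ℝ n A →
      ContDiff ℝ n (fun γ : C(K, E) => A.comp γ) := by
  induction n with
  | zero =>
    intro F _ _ A _
    exact contDiff_zero.2 (ContinuousMap.continuous_postcomp A)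
  | succ n ih =>
    intro F _ _ A hA
    have hA1 : ContDiff ℝ (n + 1) A := by exact_mod_cast hA
    obtain ⟨hd, -, hc⟩ := contDiff_succ_iff_fderiv.1 hA1
    let A' : C(E, E →L[ℝ] F) := ⟨fderiv ℝ A, hc.continuous⟩
    have h1 : ContDiff ℝ ((n : ℕ∞ω) + 1) (fun γ : C(K, E) => A.comp γ) := by
      refine contDiff_succ_iff_hasFDerivAt.2
        ⟨fun γ => pointwiseApply K E F (A'.comp γ), ?_, fun γ => ?_⟩
      · exact (pointwiseApply K E F).contDiff.comp (ih A' hc)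
      · exact hasFDerivAt_postcomp A A' (fun x => (hd x).hasFDerivAt) γ
    exact_mod_cast h1

/-- The composition operator `γ ↦ A ∘ γ` of a smooth map `A` is smooth. -/
theorem contDiff_postcomp (A : C(E, F)) (hA : ContDiff ℝ ∞ A) :
    ContDiff ℝ ∞ (fun γ : C(K, E) => A.comp γ) :=
  contDiff_infty.2 fun n => contDiff_postcomp_nat n A (contDiff_infty.1 hA n)

end CompositionOperator

/-! ### An implicit function theorem in Banach spaces -/

section ImplicitFunction

variable {P X : Type} [NormedAddCommGroup P] [NormedSpace ℝ P] [CompleteSpace P]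
  [NormedAddCommGroup X] [NormedSpace ℝ X] [CompleteSpace X]

/-- The equation `F (p, x) = 0` has a smooth solution `x = Γ p` near a solution at which the
partial derivative of `F` in `x` is the identity; the derivative of `Γ` is determined by the
linearized equation. -/
theorem exists_contDiffOn_implicit (F : P × X → X) (hF : ContDiff ℝ ∞ F) (p₀ : P) (x₀ : X)
    (h₀ : F (p₀, x₀) = 0) (h₁ : ∀ J, fderiv ℝ F (p₀, x₀) (0, J) = J) :
    ∃ (N : Set P) (Γ : P → X), IsOpen N ∧ p₀ ∈ N ∧ ContDiffOn ℝ ∞ Γ N ∧ Γ p₀ = x₀ ∧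
      ∀ p ∈ N, F (p, Γ p) = 0 ∧
        ∀ v J, fderiv ℝ F (p, Γ p) (v, J) = 0 → fderiv ℝ Γ p v = J := by
  have hFd : Differentiable ℝ F := hF.differentiable (by simp)
  -- The inverse of H, restricted to the slice P × {0}, is p ↦ (p, Γ p).
  let H : P × X → P × X := fun q => (q.1, F q)
  have hH : ContDiff ℝ ∞ H := contDiff_fst.prodMk hF
  let H' : P × X → (P × X →L[ℝ] P × X) := fun q =>
    (ContinuousLinearMap.fst ℝ P X).prod (fderiv ℝ F q)
  have hH' : ∀ q, HasFDerivAt H (H' q) q := fun q =>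
    hasFDerivAt_fst.prodMk (hFd q).hasFDerivAt
  have hH'c : Continuous H' := by
    have : Continuous (fderiv ℝ F) := hF.continuous_fderiv (by simp)
    exact (ContinuousLinearMap.prodₗᵢ ℝ : ((P × X →L[ℝ] P) × (P × X →L[ℝ] X)) ≃ₗᵢ[ℝ]
      (P × X →L[ℝ] P × X)).continuous.comp
      (continuous_const.prodMk this)
  have hsplit : ∀ v J, fderiv ℝ F (p₀, x₀) (v, J) = fderiv ℝ F (p₀, x₀) (v, 0) + J := by
    intro v J
    conv_rhs => rw [← h₁ J, ← map_add]
    simp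
  let e₀ : (P × X) ≃L[ℝ] (P × X) := ContinuousLinearEquiv.equivOfInverse (H' (p₀, x₀))
    ((ContinuousLinearMap.fst ℝ P X).prod (ContinuousLinearMap.snd ℝ P X -
      (fderiv ℝ F (p₀, x₀)).comp ((ContinuousLinearMap.inl ℝ P X).comp
        (ContinuousLinearMap.fst ℝ P X))))
    (by
      rintro ⟨v, J⟩
      refine Prod.ext rfl ?_
      change fderiv ℝ F (p₀, x₀) (v, J) - fderiv ℝ F (p₀, x₀) (v, 0) = J
      rw [hsplit v J, add_sub_cancel_left])
    (by
      rintro ⟨v, J⟩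
      refine Prod.ext rfl ?_
      change fderiv ℝ F (p₀, x₀) (v, J - fderiv ℝ F (p₀, x₀) (v, 0)) = J
      rw [hsplit v, add_sub_cancel])
  have he₀ : HasFDerivAt H (e₀ : P × X →L[ℝ] P × X) (p₀, x₀) := hH' (p₀, x₀)
  let Φ := hH.contDiffAt.toOpenPartialHomeomorph H he₀ (by simp : (∞ : ℕ∞ω) ≠ 0)
  have hΦ : ∀ q, Φ q = H q := fun q => rfl
  have hs₀ : (p₀, x₀) ∈ Φ.source :=
    hH.contDiffAt.mem_toOpenPartialHomeomorph_source he₀ (by simp)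
  have hH₀ : H (p₀, x₀) = (p₀, 0) := by simp [H, h₀]
  have ht₀ : (p₀, (0 : X)) ∈ Φ.target := by rw [← hH₀]; exact Φ.map_source hs₀
  have hsymm₀ : Φ.symm (p₀, 0) = (p₀, x₀) := by rw [← hH₀]; exact Φ.left_inv hs₀
  let I : Set (P × X →L[ℝ] P × X) :=
    Set.range ((↑) : ((P × X) ≃L[ℝ] (P × X)) → (P × X →L[ℝ] P × X))
  have hI : IsOpen I := ContinuousLinearEquiv.isOpen
  -- Invertibility of the derivative is required at every point and not only at the base point: it
  -- gives smoothness of the inverse and uniqueness for the linearized equation.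
  let T : Set (P × X) := Φ.target ∩ Φ.symm ⁻¹' (H' ⁻¹' I)
  have hT : IsOpen T := Φ.symm.isOpen_inter_preimage (hI.preimage hH'c)
  let ι : P → P × X := fun p => (p, 0)
  have hι : Continuous ι := by fun_prop
  have hΨ : ∀ q ∈ T, ContDiffAt ℝ ∞ Φ.symm q := by
    rintro q ⟨hq, ⟨e, he⟩⟩
    exact Φ.contDiffAt_symm hq (he ▸ hH' (Φ.symm q)) hH.contDiffAt
  have hfst : ∀ p ∈ ι ⁻¹' T, Φ.symm (ι p) = (p, (Φ.symm (ι p)).2) ∧ F (Φ.symm (ι p)) = 0 := by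
    intro p hp
    have h := Φ.right_inv hp.1
    rw [hΦ] at h
    have h1 : (Φ.symm (ι p)).1 = p := congrArg Prod.fst h
    exact ⟨Prod.ext h1 rfl, congrArg Prod.snd h⟩
  refine ⟨ι ⁻¹' T, fun p => (Φ.symm (ι p)).2, hT.preimage hι, ⟨ht₀, ?_⟩, ?_, ?_, ?_⟩
  · change H' (Φ.symm (p₀, 0)) ∈ I
    rw [hsymm₀]
    exact ⟨e₀, rfl⟩
  · intro p hp
    exact (contDiffAt_snd.comp p ((hΨ _ hp).comp p (contDiff_prodMk_left 0).contDiffAt)).contDiffWithinAt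
  · change (Φ.symm (p₀, 0)).2 = x₀
    rw [hsymm₀]
  · intro p hp
    obtain ⟨h1, h2⟩ := hfst p hp
    refine ⟨by rw [← h1]; exact h2, fun v J hvJ => ?_⟩
    rw [← h1] at hvJ
    have hd : HasFDerivAt Φ.symm (fderiv ℝ Φ.symm (ι p)) (ι p) :=
      ((hΨ _ hp).differentiableAt (by simp)).hasFDerivAt
    have hdι : HasFDerivAt ι (ContinuousLinearMap.inl ℝ P X) p := hasFDerivAt_prodMk_left p 0
    have hdΓ := (hd.comp p hdι).snd
    have e1 : (fun p => ((⇑Φ.symm ∘ ι) p).2) = fun p => (Φ.symm (ι p)).2 := rfl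
    rw [e1] at hdΓ
    rw [hdΓ.fderiv]
    have hcomp : HasFDerivAt (H ∘ Φ.symm) ((H' (Φ.symm (ι p))).comp (fderiv ℝ Φ.symm (ι p))) (ι p) :=
      (hH' _).comp _ hd
    have hid : H ∘ Φ.symm =ᶠ[𝓝 (ι p)] id :=
      Filter.eventuallyEq_of_mem (Φ.open_target.mem_nhds hp.1) fun q hq => Φ.right_inv hq
    have hinv := (hcomp.congr_of_eventuallyEq hid.symm).unique (hasFDerivAt_id (ι p))
    obtain ⟨e, he⟩ := hp.2
    have key : fderiv ℝ Φ.symm (ι p) (v, 0) = (v, J) := by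
      apply e.injective
      have l1 : e (fderiv ℝ Φ.symm (ι p) (v, 0)) = (v, 0) := by
        have := congrArg (fun L : P × X →L[ℝ] P × X => L (v, 0)) hinv
        rw [← he] at this
        simpa using this
      have l2 : e (v, J) = (v, 0) := by
        have : (e : P × X →L[ℝ] P × X) (v, J) = H' (Φ.symm (ι p)) (v, J) := by rw [← he]
        rw [ContinuousLinearEquiv.coe_coe] at this
        rw [this]
        simp only [H', ContinuousLinearMap.prod_apply, hvJ]
        rfl
      rw [l1, l2]
    simp [key]

end ImplicitFunction

/-! ### Smooth dependence of integral curves on parameters -/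

section IntegralEquation

variable {E : Type} [NormedAddCommGroup E] [NormedSpace ℝ E]

/-- The integral `t ↦ ∫₀ᵗ g` of a continuous curve `g` on the unit interval. -/
def primitive (E : Type) [NormedAddCommGroup E] [NormedSpace ℝ E] :
    C(unitInterval, E) →L[ℝ] C(unitInterval, E) :=
  LinearMap.mkContinuous
    { toFun := fun g => ⟨fun t => ∫ s in (0 : ℝ)..t, Set.IccExtend zero_le_one g s,
        (intervalIntegral.continuous_primitive
          (fun _ _ => (g.continuous.Icc_extend' (h := zero_le_one)).intervalIntegrable _ _)
          0).comp continuous_subtype_val⟩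
      map_add' := fun f g => by
        ext t
        exact intervalIntegral.integral_add
          ((f.continuous.Icc_extend' (h := zero_le_one)).intervalIntegrable _ _)
          ((g.continuous.Icc_extend' (h := zero_le_one)).intervalIntegrable _ _)
      map_smul' := fun c g => by
        ext t
        exact intervalIntegral.integral_smul c _ } 1
    (fun g => by
      rw [one_mul, ContinuousMap.norm_le _ (norm_nonneg _)]
      intro t
      have h := intervalIntegral.norm_integral_le_of_norm_le_const (a := (0 : ℝ)) (b := t)
        (f := Set.IccExtend zero_le_one g) (C := ‖g‖) (fun s _ => g.norm_coe_le_norm _)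
      refine h.trans ?_
      rw [sub_zero, abs_of_nonneg t.2.1]
      exact mul_le_of_le_one_right (norm_nonneg _) t.2.2)

theorem primitive_apply (g : C(unitInterval, E)) (t : unitInterval) :
    primitive E g t = ∫ s in (0 : ℝ)..t, Set.IccExtend zero_le_one g s := rfl

theorem hasDerivAt_integral_IccExtend [CompleteSpace E] (g : C(unitInterval, E)) (t : ℝ) :
    HasDerivAt (fun t : ℝ => ∫ s in (0 : ℝ)..t, Set.IccExtend zero_le_one g s)
      (Set.IccExtend zero_le_one g t) t :=
  intervalIntegral.integral_hasDerivAt_right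
    ((g.continuous.Icc_extend' (h := zero_le_one)).intervalIntegrable _ _)
    (g.continuous.Icc_extend' (h := zero_le_one)).aestronglyMeasurable.stronglyMeasurableAtFilter
    (g.continuous.Icc_extend' (h := zero_le_one)).continuousAt

/-- Constant curves. -/
def constCurve (E : Type) [NormedAddCommGroup E] [NormedSpace ℝ E] :
    E →L[ℝ] C(unitInterval, E) :=
  LinearMap.mkContinuous
    { toFun := fun x => ContinuousMap.const _ x
      map_add' := fun _ _ => rfl
      map_smul' := fun _ _ => rfl } 1
    (fun x => by
      rw [one_mul, ContinuousMap.norm_le _ (norm_nonneg _)]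
      intro t; exact le_rfl)

@[simp]
theorem constCurve_apply (x : E) (t : unitInterval) : constCurve E x t = x := rfl

/-- The curve `t ↦ (γ t, p)` in `E × E`. -/
def curveWithParam (E : Type) [NormedAddCommGroup E] [NormedSpace ℝ E] :
    E × C(unitInterval, E) →L[ℝ] C(unitInterval, E × E) :=
  ((ContinuousLinearMap.inr ℝ E E).compLeftContinuous ℝ unitInterval).comp
      ((constCurve E).comp (ContinuousLinearMap.fst ℝ _ _)) +
    ((ContinuousLinearMap.inl ℝ E E).compLeftContinuous ℝ unitInterval).comp
      (ContinuousLinearMap.snd ℝ _ _)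

@[simp]
theorem curveWithParam_apply (q : E × C(unitInterval, E)) (t : unitInterval) :
    curveWithParam E q t = (q.2 t, q.1) := by
  simp [curveWithParam]

/-- Smooth dependence on `p` of the solution of `γ' = B (γ, p)`, `γ 0 = p`, near a parameter `x₀`
for which the right hand side vanishes. -/
theorem exists_contDiffOn_integral_eq [CompleteSpace E] (B : C(E × E, E)) (hB : ContDiff ℝ ∞ B)
    (x₀ : E) (hB₀ : ∀ x, B (x, x₀) = 0) :
    ∃ (N : Set E) (Γ : E → C(unitInterval, E)), IsOpen N ∧ x₀ ∈ N ∧ ContDiffOn ℝ ∞ Γ N ∧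
      Γ x₀ = constCurve E x₀ ∧
      ∀ p ∈ N, Γ p = constCurve E p + primitive E (B.comp (curveWithParam E (p, Γ p))) ∧
        ∀ (v : E) (J G : C(unitInterval, E)),
          (∀ t, G t = fderiv ℝ B (Γ p t, p) (J t, v)) →
          J = constCurve E v + primitive E G → fderiv ℝ Γ p v = J := by
  let B' : C(E × E, E × E →L[ℝ] E) := ⟨fderiv ℝ B, hB.continuous_fderiv (by simp)⟩
  have hB' : ∀ x, HasFDerivAt B (B' x) x := fun x =>
    (hB.differentiable (by simp) x).hasFDerivAt
  let F : E × C(unitInterval, E) → C(unitInterval, E) := fun q =>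
    q.2 - constCurve E q.1 - primitive E (B.comp (curveWithParam E q))
  have hF : ContDiff ℝ ∞ F :=
    (contDiff_snd.sub ((constCurve E).contDiff.comp contDiff_fst)).sub
      ((primitive E).contDiff.comp ((contDiff_postcomp B hB).comp (curveWithParam E).contDiff))
  have hF' : ∀ q w, fderiv ℝ F q w = w.2 - constCurve E w.1 -
      primitive E (pointwiseApply _ _ _ (B'.comp (curveWithParam E q)) (curveWithParam E w)) := by
    intro q w
    have h := (hasFDerivAt_snd (𝕜 := ℝ) (p := q)).sub
      ((constCurve E).hasFDerivAt.comp q (hasFDerivAt_fst (𝕜 := ℝ) (p := q)))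
    have h2 := (primitive E).hasFDerivAt.comp q ((hasFDerivAt_postcomp B B' hB'
      (curveWithParam E q)).comp q (curveWithParam E).hasFDerivAt)
    rw [(h.sub h2).fderiv (f := F)]
    rfl
  -- As B (·, x₀) vanishes identically, the integral term contributes nothing to the partial
  -- derivative of F in γ at the base point, which is therefore the identity.
  have hB'₀ : ∀ x y, B' (x, x₀) (y, 0) = 0 := by
    intro x y
    have h1 : HasFDerivAt (fun x => B (x, x₀)) ((B' (x, x₀)).comp (ContinuousLinearMap.inl ℝ E E)) x :=
      (hB' (x, x₀)).comp x (hasFDerivAt_prodMk_left x x₀)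
    have h2 : HasFDerivAt (fun x => B (x, x₀)) (0 : E →L[ℝ] E) x := by
      simp only [hB₀]; exact hasFDerivAt_const _ _
    have := congrArg (fun L : E →L[ℝ] E => L y) (h1.unique h2)
    simpa using this
  obtain ⟨N, Γ, hN, hx, hΓ, hΓ₀, H⟩ := exists_contDiffOn_implicit F hF x₀ (constCurve E x₀)
    (by
      have : B.comp (curveWithParam E (x₀, constCurve E x₀)) = 0 := by ext t; simp [hB₀]
      simp [F, this])
    (by
      intro J
      have : pointwiseApply _ _ _ (B'.comp (curveWithParam E (x₀, constCurve E x₀)))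
          (curveWithParam E (0, J)) = 0 := by ext t; simp [hB'₀]
      rw [hF', this]; simp)
  refine ⟨N, Γ, hN, hx, hΓ, hΓ₀, fun p hp => ⟨?_, fun v J G hG hJ => (H p hp).2 v J ?_⟩⟩
  · have h := (H p hp).1
    simp only [F, sub_eq_zero] at h
    rw [← h]; abel
  · have : pointwiseApply _ _ _ (B'.comp (curveWithParam E (p, Γ p))) (curveWithParam E (v, J)) = G := by
      ext t; simp [hG, B']
    rw [hF', this]
    dsimp only
    nth_rewrite 1 [hJ]
    abel

end IntegralEquation

/-! ### Frobenius' theorem for the range of a section -/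

section Frobenius

variable {E W : Type} [NormedAddCommGroup E] [NormedSpace ℝ E] [FiniteDimensional ℝ E]
  [NormedAddCommGroup W] [NormedSpace ℝ W]

/-- Multiplication by a bump function supported in U. Composition operators on curves require
globally smooth maps. -/
theorem exists_contDiff_eqOn_nhds {G : Type} [NormedAddCommGroup G] [NormedSpace ℝ G]
    {U : Set E} (hU : IsOpen U) {x₀ : E} (hx₀ : x₀ ∈ U) {V : E → G} (hV : ContDiffOn ℝ ∞ V U) :
    ∃ (V₁ : E → G) (U₁ : Set E), ContDiff ℝ ∞ V₁ ∧ IsOpen U₁ ∧ x₀ ∈ U₁ ∧ U₁ ⊆ U ∧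
      Set.EqOn V₁ V U₁ := by
  obtain ⟨ε, hε, hb⟩ := Metric.nhds_basis_closedBall.mem_iff.1 (hU.mem_nhds hx₀)
  let χ : ContDiffBump x₀ := ⟨ε / 2, ε, by positivity, by linarith⟩
  refine ⟨fun x => χ x • V x, Metric.ball x₀ (ε / 2), ?_, Metric.isOpen_ball,
    Metric.mem_ball_self (by positivity), ?_, ?_⟩
  · refine contDiff_iff_contDiffAt.2 fun x => ?_
    by_cases hx : x ∈ U
    · exact χ.contDiffAt.smul (hV.contDiffAt (hU.mem_nhds hx))
    · have hx' : x ∉ tsupport χ := fun h => hx (hb (by rwa [χ.tsupport_eq] at h))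
      have : (fun x => χ x • V x) =ᶠ[𝓝 x] fun _ => 0 := by
        filter_upwards [notMem_tsupport_iff_eventuallyEq.1 hx'] with y hy
        simp [hy]
      exact contDiffAt_const.congr_of_eventuallyEq this
  · exact (Metric.ball_subset_closedBall.trans
      (Metric.closedBall_subset_closedBall (by linarith))).trans hb
  · intro x hx
    simp [χ.one_of_mem_closedBall (Metric.ball_subset_closedBall hx)]

/-- Frobenius' theorem for a distribution given as the range of `V x : W → E`, where `V x` is a
section of a fixed projection `π : E → W`. -/
theorem exists_first_integral_of_section {U : Set E} (hU : IsOpen U) {x₀ : E} (hx₀ : x₀ ∈ U)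
    (V : E → W →L[ℝ] E) (hV : ContDiffOn ℝ ∞ V U) (π : E →L[ℝ] W)
    (hπ : ∀ x ∈ U, ∀ w, π (V x w) = w)
    (hsymm : ∀ x ∈ U, ∀ w w', fderiv ℝ V x (V x w) w' = fderiv ℝ V x (V x w') w) :
    ∃ (N : Set E) (f : E → E), IsOpen N ∧ x₀ ∈ N ∧ N ⊆ U ∧ ContDiffOn ℝ ∞ f N ∧
      (∀ v, fderiv ℝ f x₀ v = v - V x₀ (π v)) ∧ ∀ x ∈ N, ∀ w, fderiv ℝ f x (V x w) = 0 := by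
  have : CompleteSpace E := FiniteDimensional.complete ℝ E
  obtain ⟨V₁, U₁, hV₁, hU₁, hx₁, hUU, heq⟩ := exists_contDiff_eqOn_nhds hU hx₀ hV
  have hVd : ∀ x ∈ U₁, HasFDerivAt V (fderiv ℝ V x) x := fun x hx =>
    ((hV.contDiffAt (hU.mem_nhds (hUU hx))).differentiableAt (by simp)).hasFDerivAt
  -- The curve from p follows the distribution with constant projected velocity π (x₀ - p), so at
  -- time 1 it meets the slice π = π x₀. Its endpoint is f p: the projection along leaves to that
  -- slice.
  have hBs : ContDiff ℝ ∞ (fun q : E × E => V₁ q.1 (π (x₀ - q.2))) :=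
    (hV₁.comp contDiff_fst).clm_apply (π.contDiff.comp (contDiff_const.sub contDiff_snd))
  let B : C(E × E, E) := ⟨fun q => V₁ q.1 (π (x₀ - q.2)), hBs.continuous⟩
  have hBV : ∀ x ∈ U₁, ∀ p, B (x, p) = V x (π (x₀ - p)) := fun x hx p => by
    change V₁ x (π (x₀ - p)) = _
    rw [heq hx]
  have hB' : ∀ x ∈ U₁, ∀ p a b, fderiv ℝ B (x, p) (a, b) =
      fderiv ℝ V x a (π (x₀ - p)) - V x (π b) := by
    intro x hx p a b
    have h1 : HasFDerivAt (fun q : E × E => V q.1)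
        ((fderiv ℝ V x).comp (ContinuousLinearMap.fst ℝ E E)) (x, p) :=
      (hVd x hx).comp (x, p) hasFDerivAt_fst
    have h2 : HasFDerivAt (fun q : E × E => π (x₀ - q.2))
        (π.comp (-ContinuousLinearMap.snd ℝ E E)) (x, p) :=
      π.hasFDerivAt.comp (x, p) (hasFDerivAt_snd.const_sub x₀)
    have h3 : B =ᶠ[𝓝 (x, p)] fun q => V q.1 (π (x₀ - q.2)) := by
      filter_upwards [(hU₁.preimage continuous_fst).mem_nhds (show (x, p).1 ∈ U₁ from hx)]
        with q hq using hBV q.1 hq q.2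
    rw [((h1.clm_apply h2).congr_of_eventuallyEq h3).fderiv]
    simp only [add_apply, ContinuousLinearMap.comp_apply,
      ContinuousLinearMap.flip_apply, neg_apply,
      ContinuousLinearMap.coe_fst', ContinuousLinearMap.coe_snd', map_neg]
    abel
  obtain ⟨N₀, Γ, hN₀, hxN₀, hΓ, hΓ₀, H⟩ := exists_contDiffOn_integral_eq B hBs x₀
    (fun x => by change V₁ x (π (x₀ - x₀)) = 0; simp)
  -- The whole curve must stay where V₁ agrees with V.
  let O : Set C(unitInterval, E) := {γ | Set.MapsTo γ Set.univ U₁}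
  have hO : IsOpen O := ContinuousMap.isOpen_setOfPred_mapsTo isCompact_univ hU₁
  have hN : IsOpen (N₀ ∩ Γ ⁻¹' O) := hΓ.continuousOn.isOpen_inter_preimage hN₀ hO
  have hzero : ∀ p ∈ N₀, Γ p 0 = p := by
    intro p hp
    rw [(H p hp).1]
    simp [primitive_apply]
  have hΓd : ∀ p ∈ N₀, HasFDerivAt Γ (fderiv ℝ Γ p) p := fun p hp =>
    ((hΓ.contDiffAt (hN₀.mem_nhds hp)).differentiableAt (by simp)).hasFDerivAt
  let ev : C(unitInterval, E) →L[ℝ] E := ContinuousMap.evalCLM ℝ 1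
  have hfd : ∀ p ∈ N₀, ∀ v, fderiv ℝ (fun p => Γ p 1) p v = fderiv ℝ Γ p v 1 := by
    intro p hp v
    have h : HasFDerivAt (fun p => Γ p 1) (ev.comp (fderiv ℝ Γ p)) p :=
      ev.hasFDerivAt.comp p (hΓd p hp)
    rw [h.fderiv]; rfl
  refine ⟨N₀ ∩ Γ ⁻¹' O, fun p => Γ p 1, hN, ⟨hxN₀, ?_⟩, ?_, ?_, ?_, ?_⟩
  · change Set.MapsTo (Γ x₀) Set.univ U₁
    rw [hΓ₀]
    intro t _
    exact hx₁
  · rintro p ⟨hp, hpO⟩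
    have := hpO (Set.mem_univ 0)
    rw [hzero p hp] at this
    exact hUU this
  · exact ev.contDiff.comp_contDiffOn (hΓ.mono Set.inter_subset_left)
  · intro v
    -- At p = x₀ the curve is constant, and the linearized equation reduces to J' = -V x₀ (π v) with
    -- J 0 = v.
    let J : C(unitInterval, E) := ⟨fun t => v - (t : ℝ) • V x₀ (π v), by fun_prop⟩
    have hJ : fderiv ℝ Γ x₀ v = J := by
      refine (H x₀ hxN₀).2 v J (constCurve E (-V x₀ (π v))) (fun t => ?_) ?_
      · rw [hΓ₀]
        simp [hB' x₀ hx₁]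
      · ext t
        have : Set.IccExtend (zero_le_one' ℝ) (constCurve E (-V x₀ (π v))) =
          fun _ => -V x₀ (π v) := rfl
        rw [ContinuousMap.add_apply, primitive_apply, this]
        simp [J, sub_eq_add_neg]
    rw [hfd x₀ hxN₀, hJ]
    simp [J]
  · rintro p ⟨hp, hpO⟩ w
    let γ := Γ p
    have hγO : ∀ t, γ t ∈ U₁ := fun t => hpO (Set.mem_univ t)
    have hVγ : Continuous fun t => V (γ t) := by
      have : (fun t => V (γ t)) = fun t => V₁ (γ t) := funext fun t => (heq (hγO t)).symm
      rw [this]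
      exact hV₁.continuous.comp γ.continuous
    -- A variation of p along the leaf moves γ t along the leaf, by an amount that decreases to 0 at
    -- time 1. That J solves the linearized equation is precisely the symmetry `hsymm`, with `hπ`
    -- matching the term -V (γ t) w.
    let J : C(unitInterval, E) := ⟨fun t => (1 - (t : ℝ)) • V (γ t) w,
      (continuous_const.sub continuous_subtype_val).smul (hVγ.clm_apply continuous_const)⟩
    let G : C(unitInterval, E) := ⟨fun t => fderiv ℝ B (γ t, p) (J t, V p w), by
      have : Continuous (fderiv ℝ B) := hBs.continuous_fderiv (by simp)
      fun_prop⟩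
    have hJ : fderiv ℝ Γ p (V p w) = J := by
      refine (H p hp).2 (V p w) J G (fun t => rfl) ?_
      have hpU : p ∈ U₁ := by have := hγO 0; rwa [hzero p hp] at this
      let γ' : ℝ → E := fun t => p + ∫ s in (0 : ℝ)..t,
        Set.IccExtend zero_le_one (B.comp (curveWithParam E (p, γ))) s
      have hγ' : ∀ t : unitInterval, γ' t = γ t := by
        intro t
        have := congrArg (fun c : C(unitInterval, E) => c t) (H p hp).1
        exact this.symm
      have hder : ∀ s : unitInterval, HasDerivAt (fun t : ℝ => (1 - t) • V (γ' t) w)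
          (Set.IccExtend zero_le_one G s) s := by
        intro s
        have h1 : HasDerivAt γ' (V (γ s) (π (x₀ - p))) s := by
          have := (hasDerivAt_integral_IccExtend (B.comp (curveWithParam E (p, γ))) s).const_add p
          have e : (B.comp (curveWithParam E (p, γ))) s = V (γ s) (π (x₀ - p)) := by
            rw [ContinuousMap.comp_apply, curveWithParam_apply]
            exact hBV _ (hγO s) p
          rw [Set.IccExtend_val, e] at this
          exact this
        have h2 : HasDerivAt (fun t => V (γ' t)) (fderiv ℝ V (γ s) (V (γ s) (π (x₀ - p)))) s := by
          have h3 : HasFDerivAt V (fderiv ℝ V (γ s)) (γ' s) := by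
            rw [hγ' s]; exact hVd _ (hγO s)
          exact h3.comp_hasDerivAt (s : ℝ) h1
        have h4 := ((hasDerivAt_id (s : ℝ)).const_sub 1).smul
          (h2.clm_apply (hasDerivAt_const (s : ℝ) w))
        refine h4.congr_deriv ?_
        rw [Set.IccExtend_val]
        change _ = fderiv ℝ B (γ s, p) ((1 - (s : ℝ)) • V (γ s) w, V p w)
        rw [hB' _ (hγO s), hπ p (hUU hpU), map_smul, smul_apply,
          hsymm _ (hUU (hγO s)) w]
        simp [hγ', sub_eq_add_neg]
      ext t
      have hint := intervalIntegral.integral_eq_sub_of_hasDerivAt (a := 0) (b := t)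
        (f := fun t : ℝ => (1 - t) • V (γ' t) w) (f' := Set.IccExtend zero_le_one G)
        (fun s hs => by
          rw [Set.uIcc_of_le t.2.1] at hs
          exact hder ⟨s, hs.1, hs.2.trans t.2.2⟩)
        ((G.continuous.Icc_extend' (h := zero_le_one)).intervalIntegrable _ _)
      rw [ContinuousMap.add_apply, primitive_apply, hint, hγ' t]
      have : γ' 0 = p := by simp [γ']
      simp [J, this]
    rw [hfd p hp, hJ]
    simp [J]

end Frobenius

/-! ### Frobenius' theorem for involutive distributions -/

section Frobenius

variable {E : Type} [NormedAddCommGroup E] [NormedSpace ℝ E] [FiniteDimensional ℝ E]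

/-- A smooth distribution of constant rank is locally the range of a smooth section `V` of a
projection `π` onto one of its fibres. -/
theorem exists_section_of_distribution {ι : Type} {U : Set E} (hU : IsOpen U) (X : ι → E → E)
    (hX : ∀ i, ContDiffOn ℝ ∞ (X i) U) (d : ℕ)
    (hd : ∀ x ∈ U, Module.finrank ℝ (Submodule.span ℝ (Set.range fun i => X i x)) = d)
    {x₀ : E} (hx₀ : x₀ ∈ U) :
    ∃ (W : Submodule ℝ E) (π : E →L[ℝ] W) (V : E → W →L[ℝ] E) (U₁ : Set E),
      IsOpen U₁ ∧ x₀ ∈ U₁ ∧ U₁ ⊆ U ∧ ContDiffOn ℝ ∞ V U₁ ∧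
      (∀ x ∈ U₁, ∀ w, π (V x w) = w) ∧
      ∀ x ∈ U₁, LinearMap.range (V x).toLinearMap = Submodule.span ℝ (Set.range fun i => X i x) := by
  let W := Submodule.span ℝ (Set.range fun i => X i x₀)
  obtain ⟨π₀, hπ₀⟩ := LinearMap.exists_leftInverse_of_injective W.subtype W.ker_subtype
  let π : E →L[ℝ] W := LinearMap.toContinuousLinearMap π₀
  let T : E → (ι →₀ ℝ) →ₗ[ℝ] E := fun x => Finsupp.linearCombination ℝ (fun i => X i x)
  have hT : ∀ x, LinearMap.range (T x) = Submodule.span ℝ (Set.range fun i => X i x) := fun x =>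
    Finsupp.range_linearCombination ℝ
  -- Each w ∈ W is written as a finite combination of the X i x₀. With the same coefficients at x
  -- this gives a smooth family L x that is the inclusion of W at x₀.
  obtain ⟨σ, hσ⟩ := LinearMap.exists_rightInverse_of_surjective
    ((T x₀).codRestrict W (fun c => (hT x₀).le (LinearMap.mem_range_self _ c)))
    (by
      rw [LinearMap.range_eq_top]
      rintro ⟨w, hw⟩
      obtain ⟨c, hc⟩ : w ∈ LinearMap.range (T x₀) := by rw [hT x₀]; exact hw
      exact ⟨c, Subtype.ext hc⟩)
  let L : E → W →L[ℝ] E := fun x => LinearMap.toContinuousLinearMap (T x ∘ₗ σ)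
  have hL₀ : ∀ w : W, L x₀ w = w := fun w =>
    congrArg Subtype.val (congrArg (fun f : W →ₗ[ℝ] W => f w) hσ)
  have hLs : ContDiffOn ℝ ∞ L U := by
    refine contDiffOn_clm_apply.2 fun w => ?_
    change ContDiffOn ℝ ∞ (fun x => (σ w).sum fun i a => a • X i x) U
    exact ContDiffOn.sum fun i _ => contDiffOn_const.smul (hX i)
  -- A is the identity at x₀, hence invertible nearby, and L x ∘ (A x)⁻¹ is a section of π.
  let A : E → W →L[ℝ] W := fun x => π.comp (L x)
  have hAs : ContDiffOn ℝ ∞ A U := contDiffOn_const.clm_comp hLs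
  have hA₀ : A x₀ = ContinuousLinearEquiv.refl ℝ W := by
    ext1 w
    change π₀ (L x₀ w) = w
    rw [hL₀]
    exact congrArg (fun f : W →ₗ[ℝ] W => f w) hπ₀
  let I : Set (W →L[ℝ] W) := Set.range ((↑) : (W ≃L[ℝ] W) → (W →L[ℝ] W))
  have hI : IsOpen I := ContinuousLinearEquiv.isOpen
  let V : E → W →L[ℝ] E := fun x => (L x).comp (ContinuousLinearMap.inverse (A x))
  have hπV : ∀ x ∈ U ∩ A ⁻¹' I, ∀ w, π (V x w) = w := by
    rintro x ⟨_, ⟨e, he⟩⟩ w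
    change A x (ContinuousLinearMap.inverse (A x) w) = w
    rw [← he, ContinuousLinearMap.inverse_equiv]
    simp
  refine ⟨W, π, V, U ∩ A ⁻¹' I, hAs.continuousOn.isOpen_inter_preimage hU hI,
    ⟨hx₀, ⟨_, hA₀.symm⟩⟩, Set.inter_subset_left, ?_, hπV, ?_⟩
  · rintro x ⟨hx, ⟨e, he⟩⟩
    have h1 : ContDiffAt ℝ ∞ ContinuousLinearMap.inverse (A x) := he ▸ contDiffAt_map_inverse e
    exact ((hLs.contDiffAt (hU.mem_nhds hx)).clm_comp
      (h1.comp x (hAs.contDiffAt (hU.mem_nhds hx)))).contDiffWithinAt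
  · intro x hx
    refine Submodule.eq_of_le_of_finrank_eq ?_ ?_
    · rintro _ ⟨w, rfl⟩
      rw [← hT x]
      exact LinearMap.mem_range_self _ _
    · rw [hd x hx.1, LinearMap.finrank_range_of_inj, ← hd x₀ hx₀]
      exact Function.LeftInverse.injective (hπV x hx)

/-- Frobenius' theorem: every covector at `x₀` that annihilates an involutive smooth distribution
of constant rank is the differential of a local function whose differentials annihilate the
distribution. -/
theorem exists_first_integral_of_involutive {ι : Type} {U : Set E} (hU : IsOpen U) (X : ι → E → E)
    (hX : ∀ i, ContDiffOn ℝ ∞ (X i) U) (d : ℕ)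
    (hd : ∀ x ∈ U, Module.finrank ℝ (Submodule.span ℝ (Set.range fun i => X i x)) = d)
    (hbr : ∀ x ∈ U, ∀ i j, fderiv ℝ (X j) x (X i x) - fderiv ℝ (X i) x (X j x) ∈
      Submodule.span ℝ (Set.range fun i => X i x))
    {x₀ : E} (hx₀ : x₀ ∈ U) (φ : E →L[ℝ] ℝ) (hφ : ∀ i, φ (X i x₀) = 0) :
    ∃ (N : Set E) (g : E → ℝ), IsOpen N ∧ x₀ ∈ N ∧ N ⊆ U ∧ ContDiffOn ℝ ∞ g N ∧
      fderiv ℝ g x₀ = φ ∧ ∀ x ∈ N, ∀ i, fderiv ℝ g x (X i x) = 0 := by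
  obtain ⟨W, π, V, U₁, hU₁, hx₁, hUU, hV, hπ, hr⟩ :=
    exists_section_of_distribution hU X hX d hd hx₀
  have hVπ : ∀ x ∈ U₁, ∀ y ∈ Submodule.span ℝ (Set.range fun i => X i x), V x (π y) = y := by
    intro x hx y hy
    rw [← hr x hx] at hy
    obtain ⟨w, rfl⟩ := hy
    exact congrArg (V x) (hπ x hx w)
  have hmem : ∀ x i, X i x ∈ Submodule.span ℝ (Set.range fun i => X i x) := fun x i =>
    Submodule.subset_span ⟨i, rfl⟩
  have hVd : ∀ x ∈ U₁, HasFDerivAt V (fderiv ℝ V x) x := fun x hx =>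
    ((hV.contDiffAt (hU₁.mem_nhds hx)).differentiableAt (by simp)).hasFDerivAt
  have hXd : ∀ x ∈ U₁, ∀ i, HasFDerivAt (X i) (fderiv ℝ (X i) x) x := fun x hx i =>
    (((hX i).contDiffAt (hU.mem_nhds (hUU hx))).differentiableAt (by simp)).hasFDerivAt
  -- The derivative of the identity V (π X_i) = X_i.
  have hder : ∀ x ∈ U₁, ∀ i v,
      fderiv ℝ V x v (π (X i x)) + V x (π (fderiv ℝ (X i) x v)) = fderiv ℝ (X i) x v := by
    intro x hx i v
    have h1 := (hVd x hx).clm_apply (π.hasFDerivAt.comp x (hXd x hx i))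
    have h2 : (fun y => V y (π (X i y))) =ᶠ[𝓝 x] X i :=
      Filter.eventuallyEq_of_mem (hU₁.mem_nhds hx) fun y hy => hVπ y hy _ (hmem y i)
    have h3 := congrArg (fun f : E →L[ℝ] E => f v)
      ((h1.congr_of_eventuallyEq h2.symm).unique (hXd x hx i))
    rw [add_comm]
    exact h3
  -- The difference of the two derivative identities contains the Lie bracket, which V ∘ π fixes by
  -- involutivity; only the symmetry remains.
  have hsymmX : ∀ x ∈ U₁, ∀ i j,
      fderiv ℝ V x (X j x) (π (X i x)) = fderiv ℝ V x (X i x) (π (X j x)) := by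
    intro x hx i j
    have h1 := hder x hx i (X j x)
    have h2 := hder x hx j (X i x)
    have h3 := hVπ x hx _ (hbr x (hUU hx) i j)
    rw [map_sub, map_sub] at h3
    rw [← sub_eq_zero] at h1 h2 h3 ⊢
    have h4 := congrArg₂ (· - ·) h1 h2
    have h5 := congrArg₂ (· + ·) h4 h3
    simp only [sub_zero, add_zero] at h5
    rw [← h5]
    abel
  have hsymmD : ∀ x ∈ U₁, ∀ a ∈ Submodule.span ℝ (Set.range fun i => X i x),
      ∀ b ∈ Submodule.span ℝ (Set.range fun i => X i x),
      fderiv ℝ V x a (π b) = fderiv ℝ V x b (π a) := by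
    intro x hx a ha b hb
    induction ha, hb using Submodule.span_induction₂ with
    | mem_mem a b ha hb =>
      obtain ⟨i, rfl⟩ := ha
      obtain ⟨j, rfl⟩ := hb
      exact hsymmX x hx j i
    | zero_left => simp
    | zero_right => simp
    | add_left a b c _ _ _ h1 h2 => simp [h1, h2]
    | add_right a b c _ _ _ h1 h2 => simp [h1, h2]
    | smul_left r a b _ _ h => simp [h]
    | smul_right r a b _ _ h => simp [h]
  have hVmem : ∀ x ∈ U₁, ∀ w, V x w ∈ Submodule.span ℝ (Set.range fun i => X i x) := by
    intro x hx w
    rw [← hr x hx]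
    exact ⟨w, rfl⟩
  obtain ⟨N, f, hN, hxN, hNU, hf, hf₀, hfV⟩ := exists_first_integral_of_section hU₁ hx₁ V hV π hπ
    (fun x hx w w' => by
      have := hsymmD x hx _ (hVmem x hx w) _ (hVmem x hx w')
      rwa [hπ x hx, hπ x hx] at this)
  have hg : ∀ x ∈ N, ∀ v, fderiv ℝ (fun x => φ (f x)) x v = φ (fderiv ℝ f x v) := by
    intro x hx v
    have h := φ.hasFDerivAt.comp x
      ((hf.contDiffAt (hN.mem_nhds hx)).differentiableAt (by simp)).hasFDerivAt
    have h' : HasFDerivAt (fun x => φ (f x)) _ x := h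
    rw [h'.fderiv]; rfl
  have hφ₀ : ∀ y ∈ Submodule.span ℝ (Set.range fun i => X i x₀), φ y = 0 := by
    intro y hy
    have : Submodule.span ℝ (Set.range fun i => X i x₀) ≤ LinearMap.ker φ.toLinearMap := by
      rw [Submodule.span_le]
      rintro _ ⟨i, rfl⟩
      exact hφ i
    exact this hy
  -- The derivative of f at x₀ is the projection with kernel the distribution, so composing it with
  -- φ, which vanishes there, returns φ.
  refine ⟨N, fun x => φ (f x), hN, hxN, hNU.trans hUU, φ.contDiff.comp_contDiffOn hf, ?_, ?_⟩
  · ext v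
    rw [hg x₀ hxN, hf₀, map_sub, hφ₀ _ (hVmem x₀ hx₁ _), sub_zero]
  · intro x hx i
    rw [hg x hx]
    have := hfV x hx (π (X i x))
    rw [hVπ x (hNU hx) _ (hmem x i)] at this
    rw [this, map_zero]

end Frobenius

namespace NCI

/-! ### Differentials and smooth functions in charts -/

section Charts

/-- Around `x`, the open set `U` contains a set that is a ball in the chart `e`. -/
theorem exists_ball_chart {n : ℕ} {M : Type*} [TopologicalSpace M]
    {e : OpenPartialHomeomorph M (EuclideanSpace ℝ (Fin n))}
    {U : Set M} (hU : IsOpen U) {x : M} (hxU : x ∈ U) (hx : x ∈ e.source) :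
    ∃ ε > 0, Metric.ball (e x) ε ⊆ e.target ∩ e.symm ⁻¹' U ∧
      e.source ∩ e ⁻¹' Metric.ball (e x) ε ∈ 𝓝 x := by
  obtain ⟨ε, hε, hb⟩ := Metric.isOpen_iff.1 (e.symm.isOpen_inter_preimage hU) (e x)
    ⟨e.map_source hx, by rwa [Set.mem_preimage, e.left_inv hx]⟩
  exact ⟨ε, hε, hb, (e.isOpen_inter_preimage Metric.isOpen_ball).mem_nhds
    ⟨hx, Metric.mem_ball_self hε⟩⟩

variable {n : ℕ} {M : Type*} [TopologicalSpace M] [ChartedSpace (EuclideanSpace ℝ (Fin n)) M]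

theorem diff_congr {f g : M → ℝ} {x : M} (h : f =ᶠ[𝓝 x] g) : diff n f x = diff n g x := by
  rw [diff, diff, h.mfderiv_eq]

theorem diff_const (c : ℝ) (x : M) : diff n (fun _ : M => c) x = 0 := by
  rw [diff, mfderiv_const]; rfl

variable {e : OpenPartialHomeomorph M (EuclideanSpace ℝ (Fin n))}

theorem mdifferentiableAt_chart (he : e ∈ IsManifold.maximalAtlas (𝓡 n) ∞ M) {x : M}
    (hx : x ∈ e.source) : MDifferentiableAt (𝓡 n) (𝓡 n) e x :=
  (contMDiffAt_of_mem_maximalAtlas he hx).mdifferentiableAt (by simp)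

theorem mdifferentiableAt_chart_symm (he : e ∈ IsManifold.maximalAtlas (𝓡 n) ∞ M)
    {v : EuclideanSpace ℝ (Fin n)} (hv : v ∈ e.target) :
    MDifferentiableAt (𝓡 n) (𝓡 n) e.symm v :=
  (contMDiffAt_symm_of_mem_maximalAtlas he hv).mdifferentiableAt (by simp)

theorem diff_comp_chart (he : e ∈ IsManifold.maximalAtlas (𝓡 n) ∞ M) {x : M}
    (hx : x ∈ e.source) {g : EuclideanSpace ℝ (Fin n) → ℝ} (hg : DifferentiableAt ℝ g (e x))
    (v : Tan n x) : diff n (fun p => g (e p)) x v = fderiv ℝ g (e x) (vecDiff n e x v) := by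
  have h := mfderiv_comp x (I := 𝓡 n) (I' := 𝓡 n) (I'' := 𝓘(ℝ, ℝ))
    hg.mdifferentiableAt (mdifferentiableAt_chart he hx)
  have h' : mfderiv (𝓡 n) 𝓘(ℝ, ℝ) (fun p => g (e p)) x = _ := h
  rw [diff, h', mfderiv_eq_fderiv]
  rfl

theorem diff_coord (he : e ∈ IsManifold.maximalAtlas (𝓡 n) ∞ M) {x : M}
    (hx : x ∈ e.source) (i : Fin n) (v : Tan n x) :
    diff n (fun p => e p i) x v = vecDiff n e x v i := by
  have h := diff_comp_chart he hx (g := EuclideanSpace.proj (𝕜 := ℝ) i)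
    (EuclideanSpace.proj (𝕜 := ℝ) i).differentiableAt v
  rw [ContinuousLinearMap.fderiv] at h
  exact h

theorem injective_vecDiff (he : e ∈ IsManifold.maximalAtlas (𝓡 n) ∞ M) {x : M}
    (hx : x ∈ e.source) : Function.Injective (vecDiff n e x) := by
  have h := mfderiv_comp x (I := 𝓡 n) (I' := 𝓡 n) (I'' := 𝓡 n)
    (mdifferentiableAt_chart_symm he (e.map_source hx)) (mdifferentiableAt_chart he hx)
  have h1 : e.symm ∘ e =ᶠ[𝓝 x] id :=
    Filter.eventuallyEq_of_mem (e.open_source.mem_nhds hx) fun y hy => e.left_inv hy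
  rw [h1.mfderiv_eq, mfderiv_id] at h
  refine Function.LeftInverse.injective
    (g := mfderiv (𝓡 n) (𝓡 n) e.symm (e x)) fun v => ?_
  exact (congrArg (fun L : Tan n x →L[ℝ] Tan n x => L v) h).symm

theorem surjective_vecDiff (he : e ∈ IsManifold.maximalAtlas (𝓡 n) ∞ M) {x : M}
    (hx : x ∈ e.source) : Function.Surjective (vecDiff n e x) :=
  (LinearMap.injective_iff_surjective (V := Tan n x) (f := vecDiff n e x)).1
    (injective_vecDiff he hx)

theorem SmoothOn.contDiffOn_comp_symm (he : e ∈ IsManifold.maximalAtlas (𝓡 n) ∞ M)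
    {f : M → ℝ} {U : Set M} (hf : SmoothOn n f U) :
    ContDiffOn ℝ ∞ (fun v => f (e.symm v)) (e.target ∩ e.symm ⁻¹' U) := by
  rw [← contMDiffOn_iff_contDiffOn]
  exact ContMDiffOn.comp hf ((contMDiffOn_symm_of_mem_maximalAtlas he).mono Set.inter_subset_left)
    (fun v hv => hv.2)

theorem smoothOn_comp_chart (he : e ∈ IsManifold.maximalAtlas (𝓡 n) ∞ M)
    {g : EuclideanSpace ℝ (Fin n) → ℝ} {N : Set (EuclideanSpace ℝ (Fin n))}
    (hg : ContDiffOn ℝ ∞ g N) : SmoothOn n (fun p => g (e p)) (e.source ∩ e ⁻¹' N) :=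
  ContMDiffOn.comp hg.contMDiffOn
    ((contMDiffOn_of_mem_maximalAtlas he).mono Set.inter_subset_left) (fun _ hp => hp.2)

theorem smoothOn_coord (he : e ∈ IsManifold.maximalAtlas (𝓡 n) ∞ M) (i : Fin n) :
    SmoothOn n (fun p => e p i) e.source := by
  have h := smoothOn_comp_chart he (g := EuclideanSpace.proj (𝕜 := ℝ) i) (N := Set.univ)
    (EuclideanSpace.proj (𝕜 := ℝ) i).contDiff.contDiffOn
  rw [Set.preimage_univ, Set.inter_univ] at h
  exact h

theorem SmoothOn.diff_eq_fderiv (he : e ∈ IsManifold.maximalAtlas (𝓡 n) ∞ M)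
    {f : M → ℝ} {U : Set M} (hU : IsOpen U) (hf : SmoothOn n f U) {x : M} (hxU : x ∈ U)
    (hx : x ∈ e.source) (v : Tan n x) :
    diff n f x v = fderiv ℝ (fun v => f (e.symm v)) (e x) (vecDiff n e x v) := by
  have h1 : (fun p => f (e.symm (e p))) =ᶠ[𝓝 x] f :=
    Filter.eventuallyEq_of_mem (e.open_source.mem_nhds hx) fun y hy => congrArg f (e.left_inv hy)
  rw [← diff_congr h1]
  refine diff_comp_chart he hx (g := fun v => f (e.symm v)) ?_ v
  refine ((hf.contDiffOn_comp_symm he).contDiffAt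
    ((e.symm.isOpen_inter_preimage hU).mem_nhds ⟨e.map_source hx, ?_⟩)).differentiableAt (by simp)
  rwa [Set.mem_preimage, e.left_inv hx]

end Charts

/-! ### Leaves, plaques and first integrals -/

section FirstIntegrals

variable {n r : ℕ} {M : Type*} [TopologicalSpace M] [ChartedSpace (EuclideanSpace ℝ (Fin n)) M]

/-- `f` is constant near `x` on the plaques of the chart `e`. -/
def PlaqueConstAt (r : ℕ) (e : OpenPartialHomeomorph M (EuclideanSpace ℝ (Fin n))) (f : M → ℝ)
    (x : M) : Prop :=
  ∃ V ∈ 𝓝 x, ∀ p ∈ V, ∀ q ∈ V, transverse n r (e p) = transverse n r (e q) → f p = f q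

theorem transverse_lineMap {a b : EuclideanSpace ℝ (Fin n)}
    (h : transverse n r a = transverse n r b) (t : ℝ) :
    transverse n r (AffineMap.lineMap a b t) = transverse n r a := by
  rw [AffineMap.lineMap_apply_module', map_add, map_smul, map_sub, h, sub_self, smul_zero, zero_add]

/-- A function which is locally constant on plaques is constant on leaves. -/
theorem Foliation.eq_of_mem_leaf (F : Foliation n r M) {f : M → ℝ} {U : Set M}
    (hf : ∀ x ∈ U, ∃ e ∈ F.charts, x ∈ e.source ∧ PlaqueConstAt r e f x) {x y : M}
    (hy : y ∈ F.leaf U x) : f y = f x := by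
  obtain ⟨γ, hγU, hγ⟩ := hy
  have hloc : IsLocallyConstant fun t => f (γ t) := by
    rw [IsLocallyConstant.iff_eventually_eq]
    intro t
    obtain ⟨e, he, hx, V, hV, H⟩ := hf (γ t) (hγU t)
    filter_upwards [hγ t e he hx, γ.continuous.continuousAt.preimage_mem_nhds hV] with s hs hsV
    exact H _ hsV _ (mem_of_mem_nhds hV) hs
  have := hloc.apply_eq_of_isPreconnected isPreconnected_univ (Set.mem_univ 1) (Set.mem_univ 0)
  simpa using this

/-- First integrals are locally constant on plaques. -/
theorem Foliation.IsFirstIntegralOn.plaqueConstAt {F : Foliation n r M} {f : M → ℝ} {U : Set M}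
    (hU : IsOpen U) (hf : F.IsFirstIntegralOn f U) {x : M} (hxU : x ∈ U)
    {e : OpenPartialHomeomorph M (EuclideanSpace ℝ (Fin n))} (he : e ∈ F.charts)
    (hx : x ∈ e.source) : PlaqueConstAt r e f x := by
  obtain ⟨ε, hε, hb, hV⟩ := exists_ball_chart hU hxU hx
  refine ⟨_, hV, fun p hp q hq hpq => (hf.2 p ?_ q ?_).symm⟩
  · have := (hb hp.2).2
    rwa [Set.mem_preimage, e.left_inv hp.1] at this
  -- In the chart, the segment from e p to e q stays in the ball and in one plaque. By compatibility
  -- of charts it is a leaf path for every other chart too.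
  · have hmem : ∀ t : unitInterval, AffineMap.lineMap (e p) (e q) (t : ℝ) ∈ Metric.ball (e x) ε :=
      fun t => (convex_ball _ _).lineMap_mem hp.2 hq.2 t.2
    have hc : Continuous fun t : unitInterval =>
        e.symm (AffineMap.lineMap (e p) (e q) (t : ℝ)) :=
      e.continuousOn_symm.comp_continuous
        ((AffineMap.lineMap_continuous (p := e p) (q := e q)).comp continuous_subtype_val)
        fun t => (hb (hmem t)).1
    let γ : Path p q := ⟨⟨_, hc⟩, by simp [e.left_inv hp.1], by simp [e.left_inv hq.1]⟩
    have hγe : ∀ t, γ t ∈ e.source := fun t => e.map_target (hb (hmem t)).1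
    have heγ : ∀ t, transverse n r (e (γ t)) = transverse n r (e p) := by
      intro t
      have : e (γ t) = AffineMap.lineMap (e p) (e q) (t : ℝ) := e.right_inv (hb (hmem t)).1
      rw [this, transverse_lineMap hpq]
    refine ⟨γ, fun t => (hb (hmem t)).2, fun t e' he' ht => ?_⟩
    obtain ⟨V, hV, H⟩ := F.compat e he e' he' (γ t) ⟨hγe t, ht⟩
    filter_upwards [γ.continuous.continuousAt.preimage_mem_nhds hV] with s hs
    exact H _ hs _ (mem_of_mem_nhds hV) ((heγ s).trans (heγ t).symm)

variable {e : OpenPartialHomeomorph M (EuclideanSpace ℝ (Fin n))}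

/-- In the chart, f is constant near 0 along the line through e x in the direction of v, which stays
in a plaque. -/
theorem PlaqueConstAt.diff_eq_zero (he : e ∈ IsManifold.maximalAtlas (𝓡 n) ∞ M) {f : M → ℝ}
    {U : Set M} (hU : IsOpen U) (hf : SmoothOn n f U) {x : M} (hxU : x ∈ U) (hx : x ∈ e.source)
    (h : PlaqueConstAt r e f x) {v : Tan n x} (hv : transverse n r (vecDiff n e x v) = 0) :
    diff n f x v = 0 := by
  obtain ⟨V, hV, H⟩ := h
  rw [hf.diff_eq_fderiv he hU hxU hx]
  set w := vecDiff n e x v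
  have hd : DifferentiableAt ℝ (fun v => f (e.symm v)) (e x) :=
    ((hf.contDiffOn_comp_symm he).contDiffAt
      ((e.symm.isOpen_inter_preimage hU).mem_nhds ⟨e.map_source hx, by
        rwa [Set.mem_preimage, e.left_inv hx]⟩)).differentiableAt (by simp)
  have hl : HasDerivAt (fun t : ℝ => e x + t • w) w 0 := by
    simpa using ((hasDerivAt_id (0 : ℝ)).smul_const w).const_add (e x)
  have h1 := HasFDerivAt.comp_hasDerivAt (0 : ℝ) (l := fun v => f (e.symm v))
    (f := fun t : ℝ => e x + t • w) (by simpa using hd.hasFDerivAt) hl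
  have hc : Filter.Tendsto (fun t : ℝ => e x + t • w) (𝓝 0) (𝓝 (e x)) := by
    simpa using hl.continuousAt.tendsto
  have h2 : (fun v => f (e.symm v)) ∘ (fun t : ℝ => e x + t • w) =ᶠ[𝓝 0] fun _ => f x := by
    have hV' : e.symm ⁻¹' V ∈ 𝓝 (e x) := by
      refine (e.continuousAt_symm (e.map_source hx)).preimage_mem_nhds ?_
      rwa [e.left_inv hx]
    filter_upwards [hc hV', hc (e.open_target.mem_nhds (e.map_source hx))] with t ht ht'
    refine H _ ht _ (mem_of_mem_nhds hV) ?_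
    rw [e.right_inv ht', map_add, map_smul, hv, smul_zero, add_zero]
  exact (h1.congr_of_eventuallyEq h2.symm).unique (hasDerivAt_const _ _)

/-- Points of one plaque in a chart ball are joined by a segment, along which f has zero derivative.
-/
theorem plaqueConstAt_of_diff_eq_zero (he : e ∈ IsManifold.maximalAtlas (𝓡 n) ∞ M) {f : M → ℝ}
    {U : Set M} (hU : IsOpen U) (hf : SmoothOn n f U) {x : M} (hxU : x ∈ U) (hx : x ∈ e.source)
    (h : ∀ y ∈ U ∩ e.source, ∀ v : Tan n y, transverse n r (vecDiff n e y v) = 0 →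
      diff n f y v = 0) : PlaqueConstAt r e f x := by
  obtain ⟨ε, hε, hb, hV⟩ := exists_ball_chart hU hxU hx
  refine ⟨_, hV, fun p hp q hq hpq => ?_⟩
  have hmem : ∀ t ∈ Set.Icc (0 : ℝ) 1, AffineMap.lineMap (e p) (e q) t ∈ Metric.ball (e x) ε :=
    fun t ht => (convex_ball _ _).lineMap_mem hp.2 hq.2 ht
  have hd : ∀ t ∈ Set.Icc (0 : ℝ) 1,
      HasDerivAt (fun t : ℝ => f (e.symm (AffineMap.lineMap (e p) (e q) t))) 0 t := by
    intro t ht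
    obtain ⟨htt, htU⟩ := hb (hmem t ht)
    set c := AffineMap.lineMap (e p) (e q) t with hc
    have h1 : HasFDerivAt (fun v => f (e.symm v)) (fderiv ℝ (fun v => f (e.symm v)) c) c :=
      (((hf.contDiffOn_comp_symm he).contDiffAt
        ((e.symm.isOpen_inter_preimage hU).mem_nhds ⟨htt, htU⟩)).differentiableAt
        (by simp)).hasFDerivAt
    have h2 := h1.comp_hasDerivAt t (AffineMap.hasDerivAt_lineMap (a := e p) (b := e q) (x := t))
    refine h2.congr_deriv ?_
    obtain ⟨v, hv⟩ := surjective_vecDiff he (e.map_target htt) (e q - e p)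
    have h3 := hf.diff_eq_fderiv he hU htU (e.map_target htt) v
    rw [e.right_inv htt, hv] at h3
    rw [← h3]
    refine h _ ⟨htU, e.map_target htt⟩ v ?_
    rw [hv, map_sub, hpq, sub_self]
  have := constant_of_has_deriv_right_zero
    (fun t ht => (hd t ht).continuousAt.continuousWithinAt)
    (fun t ht => (hd t ⟨ht.1, ht.2.le⟩).hasDerivWithinAt) 1 (by simp)
  simpa [e.left_inv hp.1, e.left_inv hq.1] using this.symm

namespace Foliation

/-- One chart suffices: by compatibility, the transverse coordinates of any other chart are constant
on the plaques of e, so their differentials vanish on v. -/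
theorem mem_tangent_iff (F : Foliation n r M) (he : e ∈ F.charts) {x : M} (hx : x ∈ e.source)
    (v : Tan n x) : v ∈ F.tangent x ↔ transverse n r (vecDiff n e x v) = 0 := by
  simp only [tangent, Submodule.mem_iInf, LinearMap.mem_ker, LinearMap.comp_apply]
  refine ⟨fun h => h e he hx, fun hv e' he' hx' => ?_⟩
  ext j
  change vecDiff n e' x v j.1 = 0
  rw [← diff_coord (F.smooth he') hx' j.1]
  refine PlaqueConstAt.diff_eq_zero (F.smooth he) e'.open_source (smoothOn_coord (F.smooth he') j.1)
    hx' hx ?_ hv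
  obtain ⟨V, hV, H⟩ := F.compat e he e' he' x ⟨hx, hx'⟩
  exact ⟨V, hV, fun p hp q hq hpq => congrFun (H p hp q hq hpq) j⟩

/-- Both conditions are equivalent to local constancy on plaques. This replaces the global notion of
leaf by a pointwise one. -/
theorem isFirstIntegralOn_iff (F : Foliation n r M) {f : M → ℝ} {U : Set M} (hU : IsOpen U)
    (hf : SmoothOn n f U) :
    F.IsFirstIntegralOn f U ↔ ∀ x ∈ U, diff n f x ∈ (F.tangent x).dualAnnihilator := by
  constructor
  · intro h x hxU
    obtain ⟨e, he, hx⟩ := F.cover x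
    rw [Submodule.mem_dualAnnihilator]
    intro v hv
    exact (h.plaqueConstAt hU hxU he hx).diff_eq_zero (F.smooth he) hU hf hxU hx
      ((F.mem_tangent_iff he hx v).1 hv)
  · intro h
    refine ⟨hf, fun x hxU y hy => F.eq_of_mem_leaf (fun z hz => ?_) hy⟩
    obtain ⟨e, he, hx⟩ := F.cover z
    refine ⟨e, he, hx, plaqueConstAt_of_diff_eq_zero (F.smooth he) hU hf hz hx fun y hy v hv => ?_⟩
    exact (Submodule.mem_dualAnnihilator _).1 (h y hy.1) v ((F.mem_tangent_iff he hy.2 v).2 hv)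

theorem isFirstIntegralOn_coord (F : Foliation n r M) (he : e ∈ F.charts) (j : Fin n)
    (hj : r ≤ (j : ℕ)) : F.IsFirstIntegralOn (fun p => e p j) e.source := by
  refine (F.isFirstIntegralOn_iff e.open_source (smoothOn_coord (F.smooth he) j)).2 fun x hx => ?_
  rw [Submodule.mem_dualAnnihilator]
  intro v hv
  rw [diff_coord (F.smooth he) hx]
  exact congrFun ((F.mem_tangent_iff he hx v).1 hv) ⟨j, hj⟩

theorem tangent_eq_ker (F : Foliation n r M) (he : e ∈ F.charts) {x : M} (hx : x ∈ e.source) :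
    F.tangent x = LinearMap.ker (transverse n r ∘ₗ vecDiff n e x) :=
  Submodule.ext fun v => F.mem_tangent_iff he hx v

theorem finrank_tangent (F : Foliation n r M) (x : M) : Module.finrank ℝ (F.tangent x) = r := by
  obtain ⟨e, he, hx⟩ := F.cover x
  have hs : Function.Surjective (transverse n r ∘ₗ vecDiff n e x) := by
    rw [LinearMap.coe_comp]
    refine Function.Surjective.comp (fun c => ?_) (surjective_vecDiff (F.smooth he) hx)
    refine ⟨WithLp.toLp 2 fun i => if h : r ≤ (i : ℕ) then c ⟨i, h⟩ else 0, ?_⟩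
    ext j
    change (if h : r ≤ (j.1 : ℕ) then c ⟨j.1, h⟩ else 0) = c j
    rw [dif_pos j.2]
  have h := LinearMap.finrank_range_add_finrank_ker (transverse n r ∘ₗ vecDiff n e x)
  rw [LinearMap.range_eq_top.2 hs, finrank_top, ← F.tangent_eq_ker he hx,
    Module.finrank_fintype_fun_eq_card] at h
  have h1 : Module.finrank ℝ (Tan n x) = n := finrank_euclideanSpace_fin (𝕜 := ℝ)
  have h2 : Fintype.card {i : Fin n // r ≤ (i : ℕ)} = n - r := by
    have h3 := Fintype.card_subtype_compl (fun i : Fin n => (i : ℕ) < r)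
    simp only [not_lt, Fintype.card_fin] at h3
    rw [h3]
    congr 1
    rw [Fintype.card_subtype]
    rw [Fin.card_filter_val_lt, min_eq_right F.dim_le]
  have := F.dim_le
  omega

end Foliation

end FirstIntegrals

end NCI

namespace NCI

variable {n r : ℕ} {M : Type*} [TopologicalSpace M] [ChartedSpace (EuclideanSpace ℝ (Fin n)) M]

/-! ### Hamiltonian vector fields and their Lie brackets -/

namespace PoissonStructure

variable (P : PoissonStructure n M)

theorem biv_swap (x : M) (α β : Module.Dual ℝ (Tan n x)) : P.biv x α β = -P.biv x β α := by
  have h := P.alt x (α + β)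
  simp only [map_add, LinearMap.add_apply, P.alt] at h
  linarith

theorem apply_sharp_swap (x : M) (α β : Module.Dual ℝ (Tan n x)) :
    β (P.sharp x α) = -α (P.sharp x β) := by
  rw [apply_sharp, apply_sharp, biv_swap]

theorem bracket_swap (f g : M → ℝ) (x : M) : P.bracket f g x = -P.bracket g f x :=
  P.biv_swap x _ _

theorem bracket_congr {f f' g g' : M → ℝ} {x : M} (hf : f =ᶠ[𝓝 x] f') (hg : g =ᶠ[𝓝 x] g') :
    P.bracket f g x = P.bracket f' g' x := by
  rw [bracket, bracket, bracketOf, bracketOf, diff_congr hf, diff_congr hg]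

theorem bracket_eq_zero_of_right {f g : M → ℝ} {x : M} (hg : g =ᶠ[𝓝 x] fun _ => 0) :
    P.bracket f g x = 0 := by
  rw [bracket, bracketOf, diff_congr hg, diff_const, map_zero]

theorem bracket_neg_right (f g : M → ℝ) {x : M}
    (hg : MDifferentiableAt (𝓡 n) 𝓘(ℝ, ℝ) g x) :
    P.bracket f (fun y => -g y) x = -P.bracket f g x := by
  have h : diff n (fun y => -g y) x = -diff n g x := by
    have h1 : mfderiv (𝓡 n) 𝓘(ℝ, ℝ) (fun y => -g y) x = -mfderiv (𝓡 n) 𝓘(ℝ, ℝ) g x :=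
      hg.hasMFDerivAt.neg.mfderiv
    rw [diff, h1]
    rfl
  rw [bracket, bracketOf, h, map_neg]
  rfl

theorem smoothOn_bracket {U : Set M} (hU : IsOpen U) {f g : M → ℝ} (hf : SmoothOn n f U)
    (hg : SmoothOn n g U) : SmoothOn n (P.bracket f g) U :=
  P.smooth U hU f g hf hg

theorem jacobi_bracket {U : Set M} (hU : IsOpen U) {f g h : M → ℝ} (hf : SmoothOn n f U)
    (hg : SmoothOn n g U) (hh : SmoothOn n h U) {x : M} (hx : x ∈ U) :
    P.bracket f (P.bracket g h) x + P.bracket g (P.bracket h f) x +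
      P.bracket h (P.bracket f g) x = 0 :=
  P.jacobi U hU f g h hf hg hh x hx

theorem bracket_bracket_swap {U : Set M} (hU : IsOpen U) (f : M → ℝ) {g h : M → ℝ}
    (hg : SmoothOn n g U) (hh : SmoothOn n h U) {x : M} (hx : x ∈ U) :
    P.bracket f (P.bracket g h) x = -P.bracket f (P.bracket h g) x := by
  rw [← P.bracket_neg_right f _ (((P.smoothOn_bracket hU hh hg).contMDiffAt
    (hU.mem_nhds hx)).mdifferentiableAt (by simp))]
  exact P.bracket_congr Filter.EventuallyEq.rfl (Filter.Eventually.of_forall fun y =>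
    P.bracket_swap g h y)

/-- The bracket with a Hamiltonian vector field is a derivation of the bracket. -/
theorem bracket_bracket_sub {U : Set M} (hU : IsOpen U) {f g h : M → ℝ} (hf : SmoothOn n f U)
    (hg : SmoothOn n g U) (hh : SmoothOn n h U) {x : M} (hx : x ∈ U) :
    P.bracket (P.bracket f h) g x - P.bracket (P.bracket f g) h x =
      -P.bracket f (P.bracket g h) x := by
  have h1 := P.jacobi_bracket hU hf hg hh hx
  rw [P.bracket_bracket_swap hU g hh hf hx] at h1
  rw [P.bracket_swap _ g, P.bracket_swap _ h]
  linarith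

/-- The Hamiltonian vector field `X_f`, read in the chart `e`. -/
def hamChart (e : OpenPartialHomeomorph M (EuclideanSpace ℝ (Fin n))) (f : M → ℝ)
    (v : EuclideanSpace ℝ (Fin n)) : EuclideanSpace ℝ (Fin n) :=
  vecDiff n e (e.symm v) (P.ham f (e.symm v))

variable {e : OpenPartialHomeomorph M (EuclideanSpace ℝ (Fin n))}

theorem hamChart_chart (f : M → ℝ) {x : M} (hx : x ∈ e.source) :
    P.hamChart e f (e x) = vecDiff n e x (P.ham f x) := by
  rw [hamChart, e.left_inv hx]

theorem hamChart_apply (he : e ∈ IsManifold.maximalAtlas (𝓡 n) ∞ M) (f : M → ℝ)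
    {v : EuclideanSpace ℝ (Fin n)} (hv : v ∈ e.target) (i : Fin n) :
    P.hamChart e f v i = P.bracket (fun p => e p i) f (e.symm v) := by
  rw [hamChart, ← diff_coord he (e.map_target hv), apply_ham]

/-- The components are the brackets of the coordinates with f, which are smooth by the smoothness of
Π. -/
theorem contDiffOn_hamChart (he : e ∈ IsManifold.maximalAtlas (𝓡 n) ∞ M) {f : M → ℝ} {U : Set M}
    (hU : IsOpen U) (hf : SmoothOn n f U) :
    ContDiffOn ℝ ∞ (P.hamChart e f) (e.target ∩ e.symm ⁻¹' U) := by
  rw [contDiffOn_euclidean]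
  intro i
  have h1 := (P.smoothOn_bracket (hU.inter e.open_source)
    ((smoothOn_coord he i).mono Set.inter_subset_right)
    (hf.mono Set.inter_subset_left)).contDiffOn_comp_symm he
  refine ContDiffOn.congr (h1.mono fun v hv => ⟨hv.1, hv.2, e.map_target hv.1⟩) fun v hv => ?_
  exact P.hamChart_apply he f hv.1 i

theorem fderiv_hamChart (he : e ∈ IsManifold.maximalAtlas (𝓡 n) ∞ M) (f : M → ℝ) {x : M}
    (hx : x ∈ e.source) {g : EuclideanSpace ℝ (Fin n) → ℝ} (hg : DifferentiableAt ℝ g (e x)) :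
    fderiv ℝ g (e x) (P.hamChart e f (e x)) = P.bracket (fun p => g (e p)) f x := by
  rw [hamChart, e.left_inv hx, ← diff_comp_chart he hx hg, apply_ham]

/-- The bracket of the Hamiltonian vector fields of `f` and `g` is that of `-{f, g}`. -/
theorem lieBracket_hamChart (he : e ∈ IsManifold.maximalAtlas (𝓡 n) ∞ M) {f g : M → ℝ}
    (hf : SmoothOn n f e.source) (hg : SmoothOn n g e.source) {x : M} (hx : x ∈ e.source) :
    fderiv ℝ (P.hamChart e g) (e x) (P.hamChart e f (e x)) -
      fderiv ℝ (P.hamChart e f) (e x) (P.hamChart e g (e x)) =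
      -P.hamChart e (P.bracket f g) (e x) := by
  -- Component i of the derivative of X_g along X_f is {{e_i, g}, f}; the claim is then the Jacobi
  -- identity for e_i, f, g.
  have key : ∀ {f g : M → ℝ}, SmoothOn n g e.source → ∀ i,
      fderiv ℝ (P.hamChart e g) (e x) (P.hamChart e f (e x)) i =
        P.bracket (P.bracket (fun p => e p i) g) f x := by
    intro f g hg i
    have hc := (P.contDiffOn_hamChart he e.open_source hg).contDiffAt
      ((e.symm.isOpen_inter_preimage e.open_source).mem_nhds
        ⟨e.map_source hx, e.map_target (e.map_source hx)⟩)
    have hd := hc.differentiableAt (by simp)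
    have h1 : HasFDerivAt (fun v => P.hamChart e g v i)
        ((EuclideanSpace.proj (𝕜 := ℝ) i).comp (fderiv ℝ (P.hamChart e g) (e x))) (e x) :=
      (EuclideanSpace.proj (𝕜 := ℝ) i).hasFDerivAt.comp (e x) hd.hasFDerivAt
    have h2 := P.fderiv_hamChart he f hx h1.differentiableAt
    rw [h1.fderiv] at h2
    refine Eq.trans h2 (P.bracket_congr ?_ Filter.EventuallyEq.rfl)
    refine Filter.eventuallyEq_of_mem (e.open_source.mem_nhds hx) fun y hy => ?_
    change P.hamChart e g (e y) i = _
    rw [P.hamChart_apply he g (e.map_source hy), e.left_inv hy]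
  ext i
  change fderiv ℝ (P.hamChart e g) (e x) (P.hamChart e f (e x)) i -
      fderiv ℝ (P.hamChart e f) (e x) (P.hamChart e g (e x)) i =
      -P.hamChart e (P.bracket f g) (e x) i
  rw [key hg, key hf, P.hamChart_apply he _ (e.map_source hx), e.left_inv hx]
  exact P.bracket_bracket_sub e.open_source (smoothOn_coord he i) hf hg hx

end PoissonStructure

/-! ### The two implications -/

namespace Foliation

variable {P : PoissonStructure n M} {F : Foliation n r M}

/-- First integrals commute with each f i, since X_{f i} is tangent to 𝓕; by Jacobi so do their
brackets. -/
theorem IsAbstractNCI.isPoissonComplete (h : F.IsAbstractNCI P) : F.IsPoissonComplete P := by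
  intro U hU g k hg hk
  refine (F.isFirstIntegralOn_iff hU (P.smoothOn_bracket hU hg.1 hk.1)).2 fun x hx => ?_
  obtain ⟨U', hU', hxU', f, hf, hspan⟩ := h x
  rw [Submodule.mem_dualAnnihilator]
  suffices F.tangent x ≤ LinearMap.ker (diff n (P.bracket g k) x) from fun v hv => this hv
  rw [← hspan x hxU', Submodule.span_le]
  rintro _ ⟨i, rfl⟩
  change diff n (P.bracket g k) x (P.ham (f i) x) = 0
  have hO := hU.inter hU'
  have hzero : ∀ {k : M → ℝ}, F.IsFirstIntegralOn k U →
      P.bracket k (f i) =ᶠ[𝓝 x] fun _ => 0 := by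
    intro k hk
    refine Filter.eventuallyEq_of_mem (hO.mem_nhds ⟨hx, hxU'⟩) fun y hy => ?_
    rw [← P.apply_ham]
    refine (Submodule.mem_dualAnnihilator _).1 ((F.isFirstIntegralOn_iff hU hk.1).1 hk y hy.1) _ ?_
    rw [← hspan y hy.2]
    exact Submodule.subset_span ⟨i, rfl⟩
  have hg' := hg.1.mono (Set.inter_subset_left (t := U'))
  have hk' := hk.1.mono (Set.inter_subset_left (t := U'))
  have hf' := (hf i).1.mono (Set.inter_subset_right (s := U))
  have hj := P.jacobi_bracket hO hg' hk' hf' ⟨hx, hxU'⟩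
  rw [P.bracket_bracket_swap hO k hf' hg' ⟨hx, hxU'⟩, P.bracket_eq_zero_of_right (hzero hk),
    P.bracket_eq_zero_of_right (hzero hg)] at hj
  rw [P.apply_ham, P.bracket_swap]
  linarith

theorem IsAbstractNCI.isIsotropic (h : F.IsAbstractNCI P) : F.IsIsotropic P := by
  intro x
  obtain ⟨U, hU, hx, f, hf, hspan⟩ := h x
  conv_lhs => rw [← hspan x hx]
  rw [Submodule.span_le]
  rintro _ ⟨i, rfl⟩
  refine ⟨-diff n (f i) x,
    neg_mem ((F.isFirstIntegralOn_iff hU (hf i).1).1 (hf i) x hx), ?_⟩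
  rw [map_neg]
  rfl

/-- On the annihilator of `Π^♯ (T𝓕)°`, the map `Π^♯` takes its values in `T𝓕`. -/
theorem sharp_mem_tangent {x : M} {α : Module.Dual ℝ (Tan n x)}
    (hα : ∀ β ∈ (F.tangent x).dualAnnihilator, α (P.sharp x β) = 0) :
    P.sharp x α ∈ F.tangent x := by
  rw [← Subspace.dualAnnihilator_dualCoannihilator_eq (W := F.tangent x),
    Submodule.mem_dualCoannihilator]
  intro β hβ
  rw [P.apply_sharp_swap, hα β hβ, neg_zero]

/-- Any α with Π^♯ α = v works, because α (Π^♯ β) = -β v. With `sharp_mem_tangent`, Π^♯ maps the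
annihilator of Π^♯ (T𝓕)° onto T𝓕. -/
theorem IsIsotropic.exists_sharp_eq (h : F.IsIsotropic P) {x : M} {v : Tan n x}
    (hv : v ∈ F.tangent x) : ∃ α : Module.Dual ℝ (Tan n x),
      (∀ β ∈ (F.tangent x).dualAnnihilator, α (P.sharp x β) = 0) ∧ P.sharp x α = v := by
  obtain ⟨α, hα, rfl⟩ := h x hv
  refine ⟨α, fun β hβ => ?_, rfl⟩
  rw [P.apply_sharp_swap, (Submodule.mem_dualAnnihilator _).1 hβ _ hv, neg_zero]

/-- Isotropy and antisymmetry give ker Π^♯ ⊆ (T𝓕)°, so rank–nullity yields dimension (n - r) - (n -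
rank Π). -/
theorem IsIsotropic.finrank_map_sharp (h : F.IsIsotropic P) (x : M) :
    Module.finrank ℝ ((F.tangent x).dualAnnihilator.map (P.sharp x)) + r = P.rank x := by
  have hker : LinearMap.ker (P.sharp x) ≤ (F.tangent x).dualAnnihilator := by
    intro α hα
    rw [Submodule.mem_dualAnnihilator]
    intro v hv
    obtain ⟨β, -, rfl⟩ := h x hv
    rw [P.apply_sharp_swap, LinearMap.mem_ker.1 hα, map_zero, neg_zero]
  have h1 := LinearMap.finrank_range_add_finrank_ker (P.sharp x)
  have h2 := LinearMap.finrank_range_add_finrank_ker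
    (K := ℝ) (V := (F.tangent x).dualAnnihilator) (V₂ := Tan n x)
    ((P.sharp x).domRestrict (F.tangent x).dualAnnihilator)
  rw [LinearMap.range_domRestrict, LinearMap.ker_domRestrict,
    (Submodule.comapSubtypeEquivOfLe hker).finrank_eq] at h2
  have h3 := Subspace.finrank_add_finrank_dualAnnihilator_eq (F.tangent x)
  rw [F.finrank_tangent] at h3
  rw [Subspace.dual_finrank_eq] at h1
  rw [PoissonStructure.rank]
  omega

variable {e : OpenPartialHomeomorph M (EuclideanSpace ℝ (Fin n))}

/-- `(T𝓕)°` is spanned by the differentials of the transverse coordinates. -/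
theorem dualAnnihilator_tangent (he : e ∈ F.charts) {x : M} (hx : x ∈ e.source) :
    (F.tangent x).dualAnnihilator = Submodule.span ℝ
      (Set.range fun j : {i : Fin n // r ≤ (i : ℕ)} => diff n (fun p => e p j.1) x) := by
  refine le_antisymm ?_ ?_
  · rw [F.tangent_eq_ker he hx, ← LinearMap.range_dualMap_eq_dualAnnihilator_ker]
    rintro _ ⟨φ, rfl⟩
    have : (transverse n r ∘ₗ vecDiff n e x).dualMap φ =
        ∑ j, φ (Pi.single j 1) • diff n (fun p => e p j.1) x := by
      ext v
      rw [LinearMap.sum_apply, LinearMap.dualMap_apply, LinearMap.pi_apply_eq_sum_univ φ]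
      refine Finset.sum_congr rfl fun j _ => ?_
      rw [LinearMap.smul_apply, diff_coord (F.smooth he) hx, smul_eq_mul, smul_eq_mul, mul_comm]
      congr 2
      ext i
      simp [Pi.single_apply, eq_comm]
    rw [this]
    exact Submodule.sum_mem _ fun j _ => Submodule.smul_mem _ _ (Submodule.subset_span ⟨j, rfl⟩)
  · rw [Submodule.span_le]
    rintro _ ⟨j, rfl⟩
    exact (F.isFirstIntegralOn_iff e.open_source (smoothOn_coord (F.smooth he) j.1)).1
      (F.isFirstIntegralOn_coord he j.1 j.2) x hx

theorem span_hamChart (he : e ∈ F.charts) {x : M} (hx : x ∈ e.source) :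
    Submodule.span ℝ (Set.range fun j : {i : Fin n // r ≤ (i : ℕ)} =>
      P.hamChart e (fun p => e p j.1) (e x)) =
    ((F.tangent x).dualAnnihilator.map (P.sharp x)).map (vecDiff n e x) := by
  rw [dualAnnihilator_tangent he hx, Submodule.map_span, Submodule.map_span, ← Set.range_comp,
    ← Set.range_comp]
  rw [← Submodule.span_neg (s := Set.range _)]
  congr 1
  ext w
  simp only [Set.mem_neg, Set.mem_range, Function.comp_apply, P.hamChart_chart _ hx,
    PoissonStructure.ham, map_neg, neg_inj]

theorem hamChart_mem_span (he : e ∈ F.charts) {x : M} (hx : x ∈ e.source) {f : M → ℝ}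
    (hf : diff n f x ∈ (F.tangent x).dualAnnihilator) :
    P.hamChart e f (e x) ∈ Submodule.span ℝ (Set.range fun j : {i : Fin n // r ≤ (i : ℕ)} =>
      P.hamChart e (fun p => e p j.1) (e x)) := by
  rw [span_hamChart he hx, P.hamChart_chart f hx, PoissonStructure.ham]
  exact Submodule.mem_map_of_mem (neg_mem (Submodule.mem_map_of_mem hf))

/-- A covector that annihilates `Π^♯ (T𝓕)°` is the differential of a local function whose
differentials do so. -/
theorem exists_function (hreg : P.IsRegular) (hc : F.IsPoissonComplete P) (hi : F.IsIsotropic P)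
    (he : e ∈ F.charts) {m : M} (hm : m ∈ e.source) (α : Module.Dual ℝ (Tan n m))
    (hα : ∀ β ∈ (F.tangent m).dualAnnihilator, α (P.sharp m β) = 0) :
    ∃ (U : Set M) (f : M → ℝ), IsOpen U ∧ m ∈ U ∧ U ⊆ e.source ∧ SmoothOn n f U ∧
      diff n f m = α ∧ ∀ x ∈ U, ∀ β ∈ (F.tangent x).dualAnnihilator,
        diff n f x (P.sharp x β) = 0 := by
  have hE := F.smooth he
  have hspan : ∀ x ∈ e.source, ∀ φ : Module.Dual ℝ (EuclideanSpace ℝ (Fin n)),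
      (∀ j : {i : Fin n // r ≤ (i : ℕ)}, φ (P.hamChart e (fun p => e p j.1) (e x)) = 0) ↔
      ∀ β ∈ (F.tangent x).dualAnnihilator, φ (vecDiff n e x (P.sharp x β)) = 0 := by
    intro x hx φ
    have h : Submodule.span ℝ (Set.range fun j : {i : Fin n // r ≤ (i : ℕ)} =>
        P.hamChart e (fun p => e p j.1) (e x)) ≤ LinearMap.ker φ ↔
        ((F.tangent x).dualAnnihilator.map (P.sharp x)).map (vecDiff n e x) ≤ LinearMap.ker φ := by
      rw [span_hamChart he hx]
    rw [Submodule.span_le, Submodule.map_le_iff_le_comap, Submodule.map_le_iff_le_comap] at h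
    refine ⟨fun H β hβ => h.1 ?_ hβ, fun H j => h.2 (fun β hβ => H β hβ) ⟨j, rfl⟩⟩
    rintro _ ⟨j, rfl⟩
    exact H j
  obtain ⟨k, hk⟩ := hreg
  have hcoord : ∀ j : {i : Fin n // r ≤ (i : ℕ)}, SmoothOn n (fun p => e p j.1) e.source :=
    fun j => smoothOn_coord hE j.1
  -- Through s, α becomes the covector φ on the model space.
  obtain ⟨s, hs⟩ := (vecDiff n e m).exists_leftInverse_of_injective
    (LinearMap.ker_eq_bot.2 (injective_vecDiff hE hm))
  let φ : EuclideanSpace ℝ (Fin n) →L[ℝ] ℝ := LinearMap.toContinuousLinearMap (α ∘ₗ s)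
  have hφ : ∀ v, φ (vecDiff n e m v) = α v := fun v =>
    congrArg α (congrArg (fun L : Tan n m →ₗ[ℝ] Tan n m => L v) hs)
  -- Frobenius for Π^♯ (T𝓕)° in the chart. Regularity makes its rank the constant k - r. It is
  -- involutive because brackets of transverse coordinates are first integrals by Poisson
  -- completeness, so their Hamiltonian fields remain in the distribution.
  obtain ⟨N, g, hN, hmN, hNt, hg, hg₀, hgX⟩ := exists_first_integral_of_involutive e.open_target
    (fun j : {i : Fin n // r ≤ (i : ℕ)} => P.hamChart e (fun p => e p j.1))
    (fun j => (P.contDiffOn_hamChart hE e.open_source (hcoord j)).mono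
      fun v hv => ⟨hv, e.map_target hv⟩) (k - r)
    (fun v hv => by
      obtain ⟨x, hx, rfl⟩ : ∃ x ∈ e.source, e x = v :=
        ⟨e.symm v, e.map_target hv, e.right_inv hv⟩
      have h := hi.finrank_map_sharp x
      rw [span_hamChart he hx, LinearEquiv.finrank_eq (Submodule.equivMapOfInjective _
        (injective_vecDiff hE hx) _).symm]
      rw [hk] at h
      omega)
    (fun v hv i j => by
      obtain ⟨x, hx, rfl⟩ : ∃ x ∈ e.source, e x = v :=
        ⟨e.symm v, e.map_target hv, e.right_inv hv⟩
      rw [P.lieBracket_hamChart hE (hcoord i) (hcoord j) hx]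
      have hb := hc e.source e.open_source _ _ (F.isFirstIntegralOn_coord he i.1 i.2)
        (F.isFirstIntegralOn_coord he j.1 j.2)
      exact neg_mem (hamChart_mem_span he hx
        ((F.isFirstIntegralOn_iff e.open_source hb.1).1 hb x hx)))
    (e.map_source hm) φ
    ((hspan m hm φ.toLinearMap).2 fun β hβ => (hφ _).trans (hα β hβ))
  have hgd : ∀ x ∈ e.source ∩ e ⁻¹' N, ∀ v,
      diff n (fun p => g (e p)) x v = fderiv ℝ g (e x) (vecDiff n e x v) := fun x hx v =>
    diff_comp_chart hE hx.1
      ((hg.contDiffAt (hN.mem_nhds hx.2)).differentiableAt (by simp)) v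
  refine ⟨e.source ∩ e ⁻¹' N, fun p => g (e p), e.isOpen_inter_preimage hN, ⟨hm, hmN⟩,
    Set.inter_subset_left, smoothOn_comp_chart hE hg, ?_, fun x hx β hβ => ?_⟩
  · ext v
    rw [hgd m ⟨hm, hmN⟩, hg₀, hφ]
  · rw [hgd x hx]
    exact (hspan x hx.1 (fderiv ℝ g (e x)).toLinearMap).1 (hgX _ hx.2) β hβ

theorem isAbstractNCI_of_isRegular (hreg : P.IsRegular) (hc : F.IsPoissonComplete P)
    (hi : F.IsIsotropic P) : F.IsAbstractNCI P := by
  intro m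
  obtain ⟨e, he, hm⟩ := F.cover m
  have hE := F.smooth he
  let b : Module.Basis (Fin r) ℝ (F.tangent m) := Module.finBasisOfFinrankEq ℝ _ (F.finrank_tangent m)
  choose α hα hαb using fun i => hi.exists_sharp_eq (b i).2
  choose U f hU hmU hUe hf hfm hfD using fun i => exists_function hreg hc hi he hm (α i) (hα i)
  have hO : IsOpen (⋂ i, U i) := isOpen_iInter_of_finite hU
  have hcont : ContinuousOn (fun v i => P.hamChart e (f i) v) (e.target ∩ e.symm ⁻¹' ⋂ i, U i) :=
    continuousOn_pi.2 fun i => ((P.contDiffOn_hamChart hE (hU i) (hf i)).continuousOn).mono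
      fun v hv => ⟨hv.1, Set.mem_iInter.1 hv.2 i⟩
  -- Independence is an open condition. It is tested in the chart, where the fields take values in
  -- one fixed space.
  let L : Set (Fin r → EuclideanSpace ℝ (Fin n)) := {w | LinearIndependent ℝ w}
  have hL : IsOpen L := isOpen_setOfPred_linearIndependent
  have hN := hcont.isOpen_inter_preimage (e.symm.isOpen_inter_preimage hO) hL
  have hli : ∀ x ∈ e.source, (LinearIndependent ℝ fun i => P.hamChart e (f i) (e x)) ↔
      LinearIndependent ℝ fun i => P.ham (f i) x := by
    intro x hx
    rw [← LinearMap.linearIndependent_iff (vecDiff n e x)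
      (LinearMap.ker_eq_bot.2 (injective_vecDiff hE hx))]
    simp only [P.hamChart_chart _ hx]
    rfl
  refine ⟨e.source ∩ e ⁻¹' _, e.isOpen_inter_preimage hN, ⟨hm, ⟨e.map_source hm, ?_⟩, ?_⟩, f, ?_, ?_⟩
  · rw [Set.mem_preimage, e.left_inv hm]
    exact Set.mem_iInter.2 hmU
  · refine (hli m hm).2 ?_
    have h1 : (fun i => P.ham (f i) m) = fun i => -(b i : Tan n m) := by
      funext i
      rw [PoissonStructure.ham, hfm, hαb]
    rw [h1]
    exact (b.linearIndependent.map' (F.tangent m).subtype (Submodule.ker_subtype _)).neg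
  · intro i
    have hsub : e.source ∩ e ⁻¹' (e.target ∩ e.symm ⁻¹' (⋂ i, U i) ∩
        (fun v i => P.hamChart e (f i) v) ⁻¹' L) ⊆ U i := by
      rintro x ⟨hx, ⟨-, h⟩, -⟩
      rw [Set.mem_preimage, e.left_inv hx] at h
      exact Set.mem_iInter.1 h i
    refine (F.isFirstIntegralOn_iff (e.isOpen_inter_preimage hN) ((hf i).mono hsub)).2
      fun x hx => ?_
    rw [Submodule.mem_dualAnnihilator]
    intro v hv
    -- Isotropy places T𝓕 inside Π^♯ (T𝓕)°, which d(f i) annihilates.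
    obtain ⟨β, hβ, rfl⟩ := hi x hv
    exact hfD i x (hsub hx) β hβ
  · rintro x ⟨hx, ⟨-, h⟩, hxL⟩
    rw [Set.mem_preimage, e.left_inv hx] at h
    have hind := (hli x hx).1 hxL
    refine Submodule.eq_of_le_of_finrank_eq ?_ ?_
    · rw [Submodule.span_le]
      rintro _ ⟨i, rfl⟩
      exact neg_mem (sharp_mem_tangent (hfD i x (Set.mem_iInter.1 h i)))
    · rw [F.finrank_tangent, finrank_span_eq_card hind, Fintype.card_fin]

end Foliation

end NCI

end

theorem mainTheorem3 {n r : ℕ} {M : Type*} [TopologicalSpace M] [T2Space M]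
    [SecondCountableTopology M] [ChartedSpace (EuclideanSpace ℝ (Fin n)) M]
    [IsManifold (𝓡 n) ∞ M] (P : NCI.PoissonStructure n M) (F : NCI.Foliation n r M) :
    (F.IsAbstractNCI P → F.IsPoissonComplete P ∧ F.IsIsotropic P) ∧
      (P.IsRegular → F.IsPoissonComplete P ∧ F.IsIsotropic P → F.IsAbstractNCI P) :=
  ⟨fun h => ⟨h.isPoissonComplete, h.isIsotropic⟩,
    fun hreg h => NCI.Foliation.isAbstractNCI_of_isRegular hreg h.1 h.2⟩
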